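/- **Setting.** Let $G$ be the infinite triangular grid, drawn in the plane with unit equilateral triangles as faces. A *shape* is a nonempty connected union of finitely many (closed) vertices, edges and faces of this drawing; it is *simply connected* if its complement in $\mathbb R^2$ is connected. A set $X$ of vertices of $G$ *forms* a shape $S$ if the vertices of the drawing that lie in $S$ are exactly those of $X$, and $S$ contains every edge joining two adjacent vertices of $X$. A system of particles (or a subset of it) forms $S$ if the set of vertices it occupies does. *Particles.* A contracted particle occupies one vertex (its head), an expanded one two adjacent vertices (head and tail). Each particle $p$ labels the six directions by ports $0,\dots,5$ in clockwise or counterclockwise order starting from an arbitrary direction; labelings may differ between particles but do not change as particles move. Time is divided into stages $0,1,2,\dots$. At each stage an adversary activates an arbitrary set of particles, subject only to each particle being active at infinitely many stages. All active particles simultaneously look at the six vertices around their heads, read the pending messages arriving from them, change their internal state, send messages to particles whose heads they see there, and stay, contract or expand, as prescribed by one deterministic algorithm with finitely many states and messages. A message on an oriented edge stays pending until its recipient is next active, unless a newer one on the same oriented edge overwrites it. A *round* is a span of time in which each particle is active at least once; rounds are counted consecutively from stage 0, each ending as soon as possible. *Corner particles.* All particles being contracted, an Eligible particle is a *$k$-corner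 particle* ($0\le k\le 3$) if it has exactly $k$ Eligible neighbors and, for $k=2$, these are adjacent to each other, and, for $k=3$, one of them (the *middle neighbor*) is adjacent to both others. *The lattice consumption phase.* Each particle has flags Eligible, Candidate, Stable (initially: set, not set, not set) and, for each port, a memory of the last message received through it (initially empty). No particle ever moves. An active particle does the following. 1. It sets its Stable flag if every message it now receives equals the one memorized for the same port, and clears it otherwise. It then memorizes the messages received. 2. If it has memorized from every neighbor whether that neighbor was a corner particle (and for which $k$) when it was last active, and it is Eligible, not Candidate, and Stable, and the memorized Eligible flags say that it is a $k$-corner particle, then: - if $k=0$, it sets its Candidate flag; - if $k\in\{1,2\}$, it sets its Candidate flag if all its Eligible neighbors last announced to be $k$-corner particles, and otherwise it clears its Eligible flag; - if $k=3$, it clears its Eligible flag, unless its middle neighbor last announced to be a 3-corner particle (it is *locked*), in which case it waits. In all other cases it changes neither its Eligible nor its Candidate flag. 3. It sends to all neighbors its (new) Eligible and Candidate flags and its corner status: unknown, if it has not yet received a message from all its neighbors; otherwise not a corner particle, or a $k$-corner particle, according to its own new Eligible flag and the memorized Eligible flags. **Theorem.** There is an absolute constant $K$ with the following property. Let $P$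 be a system of $n$ contracted particles, all in the initial state above and with no messages pending, that forms a simply connected shape $S_0$ at stage 0. If all particles of $P$ execute the lattice consumption phase, then, whatever the port labelings and the activations, there is a stage $s$, reached within $Kn$ rounds, where there are 1, 2 or 3 Candidate particles, which are pairwise adjacent, and all other particles are non-Eligible. Moreover, at all stages from $0$ to $s$, all particles are contracted and at their initial positions, the system forms $S_0$, and the Eligible particles form a simply connected shape. -/

import Mathlib

/-! ### The triangular grid, its drawing, and shapes -/

/-- Vertices of the infinite triangular grid, in the lattice basis formed by two unit vectors
at an angle of 60 degrees. -/
abbrev Vertex := ℤ × ℤ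

/-- The six directions of the grid, in counterclockwise order.  Arithmetic on indices in `Fin 6`
is modulo 6. -/
def dir : Fin 6 → Vertex :=
  ![(1, 0), (0, 1), (-1, 1), (-1, 0), (0, -1), (1, -1)]

def GridAdj (u v : Vertex) : Prop := ∃ i : Fin 6, v = u + dir i

abbrev Plane := EuclideanSpace ℝ (Fin 2)

/-- The canonical drawing: unit edges, one edge of each triangle parallel to the `x` axis. -/
noncomputable def point (v : Vertex) : Plane :=
  !₂[(v.1 : ℝ) + (v.2 : ℝ) / 2, Real.sqrt 3 / 2 * (v.2 : ℝ)]

/-- Closed cells of the drawing: vertices, edges and (triangular) faces. -/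
inductive IsCell : Set Plane → Prop
  | vertex (u : Vertex) : IsCell {point u}
  | edge (u : Vertex) (i : Fin 6) : IsCell (segment ℝ (point u) (point (u + dir i)))
  | face (u : Vertex) (i : Fin 6) :
      IsCell (convexHull ℝ {point u, point (u + dir i), point (u + dir (i + 1))})

/-- A shape is a nonempty connected union of finitely many cells.  By connectedness a vertex
is of use only for the shape that consists of a single vertex. -/
structure IsShape (S : Set Plane) : Prop where
  cells : ∃ F : Set (Set Plane), F.Finite ∧ (∀ C ∈ F, IsCell C) ∧ S = ⋃₀ F
  connected : IsConnected S

/-- A shape is simply connected if its complement in the plane is connected. -/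
structure IsSimplyConnectedShape (S : Set Plane) : Prop extends IsShape S where
  compl_connected : IsConnected Sᶜ

/-- The set `X` of occupied vertices forms `S`: the vertices of the drawing that lie in `S` are
exactly those of `X`, and `S` contains the edges joining adjacent vertices of `X`. -/
structure FormsShape (X : Set Vertex) (S : Set Plane) : Prop where
  vertices : ∀ v : Vertex, v ∈ X ↔ point v ∈ S
  edges : ∀ u ∈ X, ∀ v ∈ X, GridAdj u v → segment ℝ (point u) (point v) ⊆ S

/-! ### Particles, algorithms and asynchronous executions -/

/-- What a particle sees at a vertex adjacent to its head. -/
inductive Content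
  | unoccupied
  | ownTail
  | otherHead
  | otherTail
  deriving DecidableEq

inductive Operation
  | stay
  | contract
  | expand (port : Fin 6)

/-- The outcome of one activation: new internal state, outgoing messages by port (`none` means
that no message is sent), and the operation to perform. -/
structure ParticleAction (State Msg : Type) where
  state : State
  outbox : Fin 6 → Option Msg
  op : Operation

/-- A deterministic algorithm: finite sets of internal states and of messages, an initial state,
and a transition function of the internal state, the contents of the six adjacent vertices and
the six pending messages, all listed by local port. -/
structure Algorithm where
  State : Type
  Msg : Type
  finite_state : Finite State
  finite_msg : Finite Msg
  start : State
  transition : State → (Fin 6 → Content) → (Fin 6 → Option Msg) → ParticleAction State Msg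

/-- The port labeling of a particle: the direction of port 0, and whether the labels proceed in
clockwise order.  It does not depend on the position of the particle. -/
structure PortLabeling where
  zeroDir : Fin 6
  rightHanded : Bool

/-- Direction (index) of a port. -/
def PortLabeling.dirOf (l : PortLabeling) (i : Fin 6) : Fin 6 :=
  if l.rightHanded then l.zeroDir - i else l.zeroDir + i

/-- A configuration of a system with particle set `P`.  A particle is contracted if it has no
tail.  `pending u v` is the unread message on the oriented edge from `u` to `v`. -/
structure Config (A : Algorithm) (P : Type) where
  head : P → Vertex
  tail : P → Option Vertex
  state : P → A.State
  pending : Vertex → Vertex → Option A.Msg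

namespace Config

variable {A : Algorithm} {P : Type}

/-- The vertices occupied by the particles in `Q`. -/
def occupiedBy (c : Config A P) (Q : Set P) : Set Vertex :=
  {v | ∃ p ∈ Q, c.head p = v ∨ c.tail p = some v}

/-- The vertex reached through port `i` of `p`. -/
def target (c : Config A P) (l : P → PortLabeling) (p : P) (i : Fin 6) : Vertex :=
  c.head p + dir ((l p).dirOf i)

open Classical in
/-- What `p` sees through port `i`. -/
noncomputable def view (c : Config A P) (l : P → PortLabeling) (p : P) (i : Fin 6) : Content :=
  if c.tail p = some (c.target l p i) then .ownTail
  else if ∃ q, c.head q = c.target l p i then .otherHead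
  else if ∃ q, c.tail q = some (c.target l p i) then .otherTail
  else .unoccupied

/-- The message that `p` receives through port `i` if it is activated. -/
def inbox (c : Config A P) (l : P → PortLabeling) (p : P) (i : Fin 6) : Option A.Msg :=
  c.pending (c.target l p i) (c.head p)

/-- What `p` does if it is activated. -/
noncomputable def action (c : Config A P) (l : P → PortLabeling) (p : P) : ParticleAction A.State A.Msg :=
  A.transition (c.state p) (c.view l p) (c.inbox l p)

/-- The contracted active particle `p` attempts to expand toward the unoccupied vertex `v`. -/
def Attempts (c : Config A P) (l : P → PortLabeling) (act : Set P) (p : P) (v : Vertex) : Prop :=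
  p ∈ act ∧ c.tail p = none ∧
    ∃ i, (c.action l p).op = .expand i ∧ c.target l p i = v ∧ c.view l p i = .unoccupied

/-- An active particle with head `u` sends `m` to the particle whose head it sees at `v`. -/
def Sends (c : Config A P) (l : P → PortLabeling) (act : Set P) (u v : Vertex) (m : A.Msg) :
    Prop :=
  ∃ p ∈ act, c.head p = u ∧
    ∃ i, c.target l p i = v ∧ c.view l p i = .otherHead ∧ (c.action l p).outbox i = some m

/-- A message sent from `u` to `v` is delivered unless the recipient expands at this stage. -/
def Delivers (c c' : Config A P) (l : P → PortLabeling) (act : Set P) (u v : Vertex)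
    (m : A.Msg) : Prop :=
  c.Sends l act u v m ∧ ∀ q, c.head q = v → c'.head q = v

/-- One stage with set `act` of active particles leads from `c` to `c'`.  All active particles
look, read, compute and act simultaneously; which one of several particles succeeds in expanding
toward the same vertex is left open, so it is up to the adversary. -/
structure Step (l : P → PortLabeling) (act : Set P) (c c' : Config A P) : Prop where
  inactive : ∀ p ∉ act, c'.head p = c.head p ∧ c'.tail p = c.tail p ∧ c'.state p = c.state p
  state : ∀ p ∈ act, c'.state p = (c.action l p).state
  stay : ∀ p ∈ act, (c.action l p).op = .stay → c'.head p = c.head p ∧ c'.tail p = c.tail p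
  contract : ∀ p ∈ act, (c.action l p).op = .contract →
    c'.head p = c.head p ∧ c'.tail p = none
  expand : ∀ p ∈ act, ∀ i, (c.action l p).op = .expand i →
    (c.Attempts l act p (c.target l p i) ∧
      c'.head p = c.target l p i ∧ c'.tail p = some (c.head p)) ∨
    (c'.head p = c.head p ∧ c'.tail p = c.tail p)
  conflict : ∀ v, (∃ p, c.Attempts l act p v) →
    ∃! p, c.Attempts l act p v ∧ c'.head p = v
  delivered : ∀ u v m, c.Delivers c' l act u v m → c'.pending u v = some m
  read : ∀ u v, (¬ ∃ m, c.Delivers c' l act u v m) →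
    (∃ q ∈ act, c.head q = v) → c'.pending u v = none
  kept : ∀ u v, (¬ ∃ m, c.Delivers c' l act u v m) →
    (¬ ∃ q ∈ act, c.head q = v) → c'.pending u v = c.pending u v

/-- Stage 0: distinct contracted particles in the initial state, no pending messages. -/
structure IsInitial (c : Config A P) : Prop where
  head_injective : Function.Injective c.head
  contracted : ∀ p, c.tail p = none
  state : ∀ p, c.state p = A.start
  pending : ∀ u v, c.pending u v = none

end Config

/-- `c t` is the configuration at the beginning of stage `t`, and `act t` is the set of particles
that are active at stage `t`. -/
structure IsExecution {A : Algorithm} {P : Type} (l : P → PortLabeling) (act : ℕ → Set P)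
    (c : ℕ → Config A P) : Prop where
  initial : (c 0).IsInitial
  step : ∀ t, Config.Step l (act t) (c t) (c (t + 1))

/-- Every particle is active infinitely often. -/
def Fair {P : Type} (act : ℕ → Set P) : Prop := ∀ p T, ∃ t, T ≤ t ∧ p ∈ act t

/-- The stage at whose beginning exactly `k` rounds have been completed: a round ends as soon as
every particle has been active at least once since the end of the previous round. -/
noncomputable def roundEnd {P : Type} (act : ℕ → Set P) : ℕ → ℕ
  | 0 => 0
  | k + 1 => sInf {t | ∀ p, ∃ t', roundEnd act k ≤ t' ∧ t' < t ∧ p ∈ act t'}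

/-! ### The lattice consumption phase -/

/-- What a particle announces about itself: that it does not know yet if it is a corner particle,
that it is none, or that it is a `k`-corner particle. -/
inductive CornerStatus
  | unknown
  | notCorner
  | corner (k : Fin 4)
  deriving DecidableEq, Fintype

/-- The messages of the phase. -/
structure Report where
  eligible : Bool
  candidate : Bool
  status : CornerStatus
  deriving DecidableEq, Fintype

/-- The internal state: the three flags and, for each port, the last message received. -/
structure PhaseState where
  eligible : Bool
  candidate : Bool
  stable : Bool
  memory : Fin 6 → Option Report
  deriving Fintype

/-- The ports leading to neighbors (all particles are contracted in this phase). -/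
def neighborPorts (view : Fin 6 → Content) : Finset (Fin 6) := {i | view i = .otherHead}

/-- Unread messages overwrite memorized ones. -/
def updateMemory (memory inbox : Fin 6 → Option Report) (i : Fin 6) : Option Report :=
  match inbox i with
  | some m => some m
  | none => memory i

/-- The neighbors known to be Eligible. -/
def eligiblePorts (N : Finset (Fin 6)) (memory : Fin 6 → Option Report) : Finset (Fin 6) :=
  {i ∈ N | ∃ m, memory i = some m ∧ m.eligible = true}

/-- The corner type of an Eligible particle, given the set `E` of ports that lead to Eligible
neighbors.  The neighbors at ports `i` and `j` are adjacent if and only if `j = i + 1` or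
`i = j + 1` (modulo 6), whatever the handedness. -/
def cornerType (E : Finset (Fin 6)) : CornerStatus :=
  if E = ∅ then .corner 0
  else if ∃ i, E = {i} then .corner 1
  else if ∃ i, E = {i, i + 1} then .corner 2
  else if ∃ i, E = {i - 1, i, i + 1} then .corner 3
  else .notCorner

/-- What a particle knows about its own corner status. -/
def ownStatus (eligible : Bool) (N : Finset (Fin 6)) (memory : Fin 6 → Option Report) :
    CornerStatus :=
  if ∃ i ∈ N, memory i = none then .unknown
  else if eligible then cornerType (eligiblePorts N memory)
  else .notCorner

/-- The last corner status announced by the neighbor at port `i`. -/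
def announced (memory : Fin 6 → Option Report) (i : Fin 6) : CornerStatus :=
  match memory i with
  | some m => m.status
  | none => .unknown

/-- A 3-corner particle is locked if its middle neighbor is a 3-corner particle, too. -/
def IsLocked (E : Finset (Fin 6)) (memory : Fin 6 → Option Report) : Prop :=
  ∃ i, E = {i - 1, i, i + 1} ∧ announced memory i = .corner 3

inductive Decision
  | wait
  | becomeCandidate
  | eliminate

open Classical in
/-- The decision of an Eligible, non-Candidate, Stable particle that knows the corner status last
announced by each of its neighbors. -/
noncomputable def decision (E : Finset (Fin 6)) (memory : Fin 6 → Option Report) : Decision :=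
  if cornerType E = .corner 0 then .becomeCandidate
  else if cornerType E = .corner 1 then
    if ∀ i ∈ E, announced memory i = .corner 1 then .becomeCandidate else .eliminate
  else if cornerType E = .corner 2 then
    if ∀ i ∈ E, announced memory i = .corner 2 then .becomeCandidate else .eliminate
  else if cornerType E = .corner 3 then
    if IsLocked E memory then .wait else .eliminate
  else .wait

open Classical in
/-- One activation of a particle.  The Stable flag is cleared if some message received differs
from the last one received from the same neighbor, and it is set otherwise. -/
noncomputable def phaseTransition (q : PhaseState) (view : Fin 6 → Content)
    (inbox : Fin 6 → Option Report) : ParticleAction PhaseState Report :=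
  let N := neighborPorts view
  let memory := updateMemory q.memory inbox
  let stable : Bool := decide (∀ i m, inbox i = some m → q.memory i = some m)
  let d : Decision :=
    if (∀ i ∈ N, announced memory i ≠ .unknown) ∧
        q.eligible = true ∧ q.candidate = false ∧ stable = true
    then decision (eligiblePorts N memory) memory
    else .wait
  let eligible : Bool := match d with
    | .eliminate => false
    | _ => q.eligible
  let candidate : Bool := match d with
    | .becomeCandidate => true
    | _ => q.candidate
  { state := ⟨eligible, candidate, stable, memory⟩
    outbox := fun i =>
      if i ∈ N then some ⟨eligible, candidate, ownStatus eligible N memory⟩ else none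
    op := .stay }

/-- The lattice consumption phase as an algorithm. -/
noncomputable def latticeConsumption : Algorithm where
  State := PhaseState
  Msg := Report
  finite_state := inferInstance
  finite_msg := inferInstance
  start := ⟨true, false, false, fun _ => none⟩
  transition := phaseTransition

namespace Config

variable {P : Type}

/-- The Eligible flag of particle `p` is set. -/
def Eligible (c : Config latticeConsumption P) (p : P) : Prop :=
  PhaseState.eligible (c.state p) = true

/-- The Candidate flag of particle `p` is set. -/
def Candidate (c : Config latticeConsumption P) (p : P) : Prop :=
  PhaseState.candidate (c.state p) = true

end Config

/-! ### Neighborhoods in the triangular grid -/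

/-! Let `E` be the set of vertices of Eligible particles. At every stage `E` is nonempty, and both
`E` and its complement are connected in the grid. At stage 0 this is read off the drawing
(`gridConnected_of_formsShape`, `gridConnected_compl_of_formsShape`), and
`isSimplyConnectedShape_spannedShape` converts it back into a simply connected shape, so that the
remaining argument is combinatorial.

Safety. Eligible flags that a particle reads are current, but corner statuses may be outdated. A
particle that decides is Stable, however: its memory already equals what it reads now, so the status
that it announced last is its true one. Thus particles eliminated at the same stage are not misled
about each other (`IsExecution.eliminable`). It follows that each of them has a surviving neighbor
adjacent to all its other Eligible neighbors (`Eliminable.dominated`). Sending each eliminated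
vertex to such a neighbor retracts `E` onto what remains (`GridConnected.diff`), and each eliminated
vertex touches the old complement (`GridConnected.compl_diff`).

Candidates. Outdated memory can only overestimate the Eligible neighborhood. Hence, if a `k`-corner
particle, `k ≤ 2`, hears `k` from all its Eligible neighbors, no further vertex is attached to any
of them, and `E` is a clique (`pairwise_of_corner`, `IsExecution.isFinal_of_becomeCandidate`).
Moreover all knowledge is then exact, so that nobody is eliminated any more
(`IsExecution.IsFinal.eligible_succ`).

Progress. If no flag changes for four rounds, all knowledge is exact and a particle that is
Eligible, but not Candidate, is no corner or a locked 3-corner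
(`IsExecution.waits_of_flagsConstant`). This cannot hold for all of `E`: by
`exists_unlocked_corner`, a set without holes has an unlocked corner. That lemma is a discharging
argument. The curvatures add up to six times the Euler characteristic of the complex spanned by `E`,
which is positive (`six_le_totalCurvature`), but locked 3-corners can pass all their curvature on to
vertices whose curvature is negative enough to absorb it. So some flag changes in every four rounds
until all Eligible particles are Candidates; as there are `2n` flags, each changing at most once,
`8n` rounds suffice. -/

theorem dir_add_three (i : Fin 6) : dir (i + 3) = -dir i := by
  revert i; decide

theorem dir_add_dir_add_two (i : Fin 6) : dir i + dir (i + 2) = dir (i + 1) := by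
  revert i; decide

theorem dir_add_dir_add_four (i : Fin 6) : dir i + dir (i + 4) = dir (i + 5) := by
  revert i; decide

theorem dir_ne_zero (i : Fin 6) : dir i ≠ 0 := by
  revert i; decide

theorem dir_injective : Function.Injective dir := by
  intro i j; revert i j; decide

theorem add_dir_add_dir_three (v : Vertex) (i : Fin 6) : v + dir i + dir (i + 3) = v := by
  rw [dir_add_three]; abel

theorem add_dir_add_dir_two (v : Vertex) (i : Fin 6) :
    v + dir i + dir (i + 2) = v + dir (i + 1) := by
  rw [add_assoc, dir_add_dir_add_two]

theorem add_dir_add_dir_four (v : Vertex) (i : Fin 6) :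
    v + dir i + dir (i + 4) = v + dir (i + 5) := by
  rw [add_assoc, dir_add_dir_add_four]

theorem GridAdj.symm {u v : Vertex} (h : GridAdj u v) : GridAdj v u := by
  obtain ⟨i, rfl⟩ := h
  exact ⟨i + 3, (add_dir_add_dir_three u i).symm⟩

theorem gridAdj_add_dir (v : Vertex) (i : Fin 6) : GridAdj v (v + dir i) := ⟨i, rfl⟩

theorem gridAdj_dir_dir {i j : Fin 6} (h : j = i + 1 ∨ i = j + 1) (v : Vertex) :
    GridAdj (v + dir i) (v + dir j) := by
  rcases h with rfl | rfl
  · exact ⟨i + 2, (add_dir_add_dir_two v i).symm⟩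
  · exact GridAdj.symm ⟨j + 2, (add_dir_add_dir_two v j).symm⟩

theorem gridAdj_add_dir_iff {i j : Fin 6} {v : Vertex} :
    GridAdj (v + dir i) (v + dir j) ↔ j = i + 1 ∨ i = j + 1 := by
  refine ⟨?_, fun h => gridAdj_dir_dir h v⟩
  rintro ⟨k, hk⟩
  rw [add_assoc, add_right_inj] at hk
  revert hk
  revert i j k; decide

open Classical in
/-- The directions that lead from `v` to a vertex of `E`. -/
noncomputable def nbrs (E : Set Vertex) (v : Vertex) : Finset (Fin 6) := {i | v + dir i ∈ E}

theorem mem_nbrs {E : Set Vertex} {v : Vertex} {i : Fin 6} : i ∈ nbrs E v ↔ v + dir i ∈ E := by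
  simp [nbrs]

theorem add_three_mem_nbrs {E : Set Vertex} {v : Vertex} {i : Fin 6} :
    i + 3 ∈ nbrs E (v + dir i) ↔ v ∈ E := by
  rw [mem_nbrs, add_dir_add_dir_three]

theorem add_two_mem_nbrs {E : Set Vertex} {v : Vertex} {i : Fin 6} :
    i + 2 ∈ nbrs E (v + dir i) ↔ i + 1 ∈ nbrs E v := by
  rw [mem_nbrs, mem_nbrs, add_dir_add_dir_two]

theorem add_four_mem_nbrs {E : Set Vertex} {v : Vertex} {i : Fin 6} :
    i + 4 ∈ nbrs E (v + dir i) ↔ i + 5 ∈ nbrs E v := by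
  rw [mem_nbrs, mem_nbrs, add_dir_add_dir_four]

/-! ### Connectedness in the grid -/

/-- There is a path from `u` to `v` inside `X`. -/
def Linked (X : Set Vertex) : Vertex → Vertex → Prop :=
  Relation.ReflTransGen fun a b => GridAdj a b ∧ a ∈ X ∧ b ∈ X

def GridConnected (X : Set Vertex) : Prop := ∀ u ∈ X, ∀ v ∈ X, Linked X u v

theorem Linked.symm {X : Set Vertex} {u v : Vertex} (h : Linked X u v) : Linked X v u := by
  induction h with
  | refl => exact .refl
  | tail _ h ih => exact .head ⟨h.1.symm, h.2.2, h.2.1⟩ ih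

theorem Linked.single {X : Set Vertex} {u v : Vertex} (h : GridAdj u v) (hu : u ∈ X)
    (hv : v ∈ X) : Linked X u v :=
  Relation.ReflTransGen.single ⟨h, hu, hv⟩

theorem Linked.mono {X Y : Set Vertex} (h : X ⊆ Y) {u v : Vertex} (huv : Linked X u v) :
    Linked Y u v :=
  Relation.ReflTransGen.mono (fun _ _ h' => ⟨h'.1, h h'.2.1, h h'.2.2⟩) _ _ huv

/-- A path from inside `F` to outside `F` leaves `F` somewhere. -/
theorem Linked.exists_exit {X F : Set Vertex} {u v : Vertex} (h : Linked X u v) (hu : u ∈ F)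
    (hv : v ∉ F) : ∃ a b, GridAdj a b ∧ a ∈ X ∧ b ∈ X ∧ a ∈ F ∧ b ∉ F := by
  induction h with
  | refl => exact absurd hu hv
  | @tail b c _ hbc ih =>
    by_cases hb : b ∈ F
    · exact ⟨b, c, hbc.1, hbc.2.1, hbc.2.2, hb, hv⟩
    · exact ih hb

theorem GridConnected.eq_of_closed {X F : Set Vertex} (hX : GridConnected X) {u : Vertex}
    (hu : u ∈ X) (huF : u ∈ F)
    (hF : ∀ a b, GridAdj a b → a ∈ X → b ∈ X → a ∈ F → b ∈ F) : X ⊆ F := by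
  intro v hv
  by_contra hvF
  obtain ⟨a, b, h, ha, hb, haF, hbF⟩ := (hX u hu v hv).exists_exit huF hvF
  exact hbF (hF a b h ha hb haF)

/-- Removing `v` from `X`, a path either survives or leads to a neighbor of `v`. -/
theorem Linked.diff_singleton {X : Set Vertex} {u w v : Vertex} (h : Linked X u w)
    (hu : u ≠ v) : (w ≠ v ∧ Linked (X \ {v}) u w) ∨
      ∃ i ∈ nbrs X v, Linked (X \ {v}) u (v + dir i) := by
  induction h with
  | refl => exact Or.inl ⟨hu, .refl⟩
  | @tail b c _ hbc ih =>
    rcases ih with ⟨hb, ih⟩ | ih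
    · by_cases hc : c = v
      · subst hc
        obtain ⟨i, rfl⟩ := hbc.1.symm
        exact Or.inr ⟨i, mem_nbrs.2 hbc.2.1, ih⟩
      · exact Or.inl ⟨hc, ih.tail ⟨hbc.1, ⟨hbc.2.1, hb⟩, ⟨hbc.2.2, hc⟩⟩⟩
    · exact Or.inr ih

/-! ### Curvature -/

/-- Six times the curvature of a vertex whose neighbors lie in the directions `A`. -/
def curvature (A : Finset (Fin 6)) : ℤ :=
  6 - 3 * (A.card : ℤ) + 2 * ((A.filter fun i => i + 1 ∈ A).card : ℤ)

/-- The last directions of the maximal arcs of `A`. -/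
def arcEnds (A : Finset (Fin 6)) : Finset (Fin 6) := A.filter fun i => i + 1 ∉ A

noncomputable def totalCurvature (E : Finset Vertex) : ℤ := ∑ v ∈ E, curvature (nbrs E v)

/-- A new neighbor brings one edge, which costs 3, and one triangle, worth 2, for each of the two
cyclically adjacent directions already present. -/
theorem curvature_insert (A : Finset (Fin 6)) (i : Fin 6) (hi : i ∉ A) :
    curvature (insert i A) - curvature A =
      -3 + 2 * (if i + 1 ∈ A then 1 else 0) + 2 * (if i + 5 ∈ A then 1 else 0) := by
  revert A i; decide +kernel

/-- The left side is what a new vertex contributes plus what its neighbors gain. A vertex without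
neighbors and one surrounded by six both have no arc ends: the first adds a component, the second
fills a hole, and either gives 6. -/
theorem curvature_add_sum (A : Finset (Fin 6)) :
    curvature A + ∑ i ∈ A, (-3 + 2 * (if i + 5 ∈ A then 1 else 0) +
      2 * (if i + 1 ∈ A then 1 else 0) : ℤ) = 6 * (1 - ((arcEnds A).card : ℤ)) := by
  revert A; decide +kernel

theorem nbrs_insert_self (E : Set Vertex) (v : Vertex) : nbrs (insert v E) v = nbrs E v := by
  ext i
  simp [mem_nbrs, Set.mem_insert_iff, dir_ne_zero]

theorem nbrs_insert_of_adj (E : Set Vertex) (v : Vertex) (j : Fin 6) :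
    nbrs (insert v E) (v + dir j) = insert (j + 3) (nbrs E (v + dir j)) := by
  ext i
  have key : v + dir j + dir i = v ↔ i = j + 3 := by
    rw [add_assoc, add_eq_left, ← dir_injective.eq_iff (a := i), dir_add_three, add_comm,
      add_eq_zero_iff_eq_neg]
  rw [Finset.mem_insert, mem_nbrs, mem_nbrs, Set.mem_insert_iff, key]

theorem nbrs_insert_of_not_adj {E : Set Vertex} {u v : Vertex} (h : ∀ i, v + dir i ≠ u) :
    nbrs (insert v E) u = nbrs E u := by
  ext i
  have : u + dir i ≠ v := fun h' => by
    obtain ⟨j, hj⟩ := GridAdj.symm ⟨i, h'.symm⟩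
    exact h j hj.symm
  simp [mem_nbrs, Set.mem_insert_iff, this]

/-- Only the neighborhoods of the neighbors of `v` change. In terms of the Euler characteristic this
is the gluing formula for a cone over the link of `v`, whose own characteristic is its number of
arcs (0 for the full circle). -/
theorem totalCurvature_insert {E : Finset Vertex} {v : Vertex} (hv : v ∉ E) :
    totalCurvature (insert v E) =
      totalCurvature E + 6 * (1 - ((arcEnds (nbrs E v)).card : ℤ)) := by
  have h1 : ∑ u ∈ E, (curvature (nbrs (insert v (E : Set Vertex)) u) - curvature (nbrs E u)) =
      ∑ i ∈ nbrs E v, (-3 + 2 * (if i + 5 ∈ nbrs E v then 1 else 0) +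
        2 * (if i + 1 ∈ nbrs E v then 1 else 0) : ℤ) := by
    have hinj : Function.Injective fun i => v + dir i := fun i j h =>
      dir_injective (add_left_cancel h)
    have hsub : (nbrs E v).image (fun i => v + dir i) ⊆ E := by
      intro u hu
      obtain ⟨i, hi, rfl⟩ := Finset.mem_image.1 hu
      exact mem_nbrs.1 hi
    rw [← Finset.sum_subset hsub, Finset.sum_image fun i _ j _ h => hinj h]
    · refine Finset.sum_congr rfl fun i _ => ?_
      have hi : i + 3 ∉ nbrs (E : Set Vertex) (v + dir i) := by
        rw [add_three_mem_nbrs]; exact hv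
      rw [nbrs_insert_of_adj, curvature_insert _ _ hi, add_assoc i, add_assoc i,
        show (3 + 1 : Fin 6) = 4 from rfl, show (3 + 5 : Fin 6) = 2 from rfl]
      simp only [add_two_mem_nbrs, add_four_mem_nbrs]
    · intro u hu hu'
      rw [nbrs_insert_of_not_adj, sub_self]
      rintro i rfl
      exact hu' (Finset.mem_image.2 ⟨i, mem_nbrs.2 hu, rfl⟩)
  rw [Finset.sum_sub_distrib] at h1
  have h2 := curvature_add_sum (nbrs E v)
  rw [totalCurvature, totalCurvature, Finset.sum_insert hv, Finset.coe_insert,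
    nbrs_insert_self]
  linarith

/-! ### The total curvature of a set without holes -/

/-- `E` has at most as many components as its total curvature, divided by six, indicates. -/
def FewComponents (E : Finset Vertex) : Prop :=
  ∃ T ⊆ E, 6 * (T.card : ℤ) ≤ totalCurvature E ∧ ∀ u ∈ E, ∃ t ∈ T, Linked E u t

/-- Every neighbor of `v` is linked to the last one of its arc. -/
theorem exists_arcEnd {E : Set Vertex} {v : Vertex} (hA : nbrs E v ≠ Finset.univ) {i : Fin 6}
    (hi : i ∈ nbrs E v) : ∃ j ∈ arcEnds (nbrs E v), Linked E (v + dir i) (v + dir j) := by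
  by_contra! hno
  -- An arc whose end is never reached goes all the way around `v`.
  have hstep : ∀ k : ℕ, i + k • 1 ∈ nbrs E v ∧
      Linked E (v + dir i) (v + dir (i + k • 1)) := by
    intro k
    induction k with
    | zero => simpa using ⟨hi, .refl⟩
    | succ k ih =>
      have hmem : i + k • 1 + 1 ∈ nbrs E v := by
        by_contra h
        exact hno _ (Finset.mem_filter.2 ⟨ih.1, h⟩) ih.2
      rw [succ_nsmul, ← add_assoc]
      exact ⟨hmem, ih.2.tail ⟨gridAdj_dir_dir (Or.inl rfl) v, mem_nbrs.1 ih.1, mem_nbrs.1 hmem⟩⟩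
  refine hA (Finset.eq_univ_iff_forall.2 fun j => ?_)
  have hval : ∀ x : Fin 6, x.val • (1 : Fin 6) = x := by decide
  have := (hstep (j - i).val).1
  rwa [hval, add_sub_cancel] at this

/-- Removing `v` breaks its component into at most as many pieces as there are arcs around `v`,
while a sixth of the total curvature changes by exactly the number of arcs minus one. The full
circle must be excluded, since removing its center opens a hole. -/
theorem FewComponents.of_insert {E : Finset Vertex} {v : Vertex} (hv : v ∉ E)
    (hA : nbrs E v ≠ Finset.univ) (h : FewComponents (insert v E)) : FewComponents E := by
  obtain ⟨T, hT, hcard, hlink⟩ := h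
  obtain ⟨t, htT, ht⟩ := hlink v (Finset.mem_insert_self v E)
  have hdiff : ((insert v E : Finset Vertex) : Set Vertex) \ {v} = E := by
    ext u
    by_cases hu : u = v
    · simp [hu, hv]
    · simp [hu]
  have hnbrs : nbrs ((insert v E : Finset Vertex) : Set Vertex) v = nbrs E v := by
    rw [Finset.coe_insert, nbrs_insert_self]
  -- the representatives of the arcs around `v` replace `t`
  have key : ∀ u ∈ E, ∀ w, Linked (insert v E : Finset Vertex) u w →
      Linked E u w ∧ w ≠ v ∨ ∃ j ∈ arcEnds (nbrs E v), Linked E u (v + dir j) := by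
    intro u hu w huw
    have := huw.diff_singleton (v := v) (by rintro rfl; exact hv hu)
    rw [hdiff, hnbrs] at this
    rcases this with h | ⟨i, hi, h⟩
    · exact Or.inl ⟨h.2, h.1⟩
    · obtain ⟨j, hj, hj'⟩ := exists_arcEnd hA hi
      exact Or.inr ⟨j, hj, h.trans hj'⟩
  -- `T` need not be minimal, so it may contain `v` besides `t`; `v` has to go in any case.
  refine ⟨(T.erase t).erase v ∪ (arcEnds (nbrs E v)).image (fun j => v + dir j), ?_, ?_, ?_⟩
  · intro u hu
    rcases Finset.mem_union.1 hu with hu | hu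
    · have h1 := Finset.mem_erase.1 hu
      exact Finset.mem_of_mem_insert_of_ne (hT (Finset.mem_of_mem_erase h1.2)) h1.1
    · obtain ⟨j, hj, rfl⟩ := Finset.mem_image.1 hu
      exact mem_nbrs.1 (Finset.mem_filter.1 hj).1
  · rw [totalCurvature_insert hv] at hcard
    have h1 := Finset.card_union_le ((T.erase t).erase v)
      ((arcEnds (nbrs (E : Set Vertex) v)).image (fun j => v + dir j))
    have h2 : ((T.erase t).erase v).card ≤ (T.erase t).card := Finset.card_erase_le
    have h3 := Finset.card_erase_add_one htT
    have h4 : ((arcEnds (nbrs (E : Set Vertex) v)).image (fun j => v + dir j)).card ≤ _ :=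
      Finset.card_image_le
    zify at h1 h2 h3 h4
    linarith
  · intro u hu
    have hrep : (∃ j ∈ arcEnds (nbrs E v), Linked E u (v + dir j)) →
        ∃ t' ∈ (T.erase t).erase v ∪ (arcEnds (nbrs E v)).image (fun j => v + dir j),
          Linked E u t' := by
      rintro ⟨j, hj, h⟩
      exact ⟨_, Finset.mem_union_right _ (Finset.mem_image_of_mem _ hj), h⟩
    obtain ⟨w, hw, huw⟩ := hlink u (Finset.mem_insert_of_mem hu)
    rcases key u hu w huw with ⟨h, hwv⟩ | h
    · by_cases hwt : w = t
      · subst hwt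
        refine hrep ?_
        -- Since `u` and `v` share the representative `t`, a path from `u` to `v` exists and must
        -- arrive at a neighbor of `v`.
        rcases key u hu v (huw.trans ht.symm) with h' | h'
        · exact absurd rfl h'.2
        · exact h'
      · exact ⟨w, Finset.mem_union_left _
          (Finset.mem_erase.2 ⟨hwv, Finset.mem_erase.2 ⟨hwt, hw⟩⟩), h⟩
    · exact hrep h

/-- With a single arc the total curvature is unchanged and `v` joins an existing component, so the
same representatives serve. -/
theorem FewComponents.insert {E : Finset Vertex} {v : Vertex} (hv : v ∉ E)
    (hA : (arcEnds (nbrs E v)).card = 1) (h : FewComponents E) :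
    FewComponents (insert v E) := by
  obtain ⟨T, hT, hcard, hlink⟩ := h
  have hsub : (E : Set Vertex) ⊆ (Insert.insert v E : Finset Vertex) := by simp
  refine ⟨T, hT.trans (Finset.subset_insert v E), ?_, ?_⟩
  · rw [totalCurvature_insert hv, hA]; simpa using hcard
  · intro u hu
    rcases Finset.mem_insert.1 hu with rfl | hu
    · obtain ⟨j, hj⟩ := Finset.card_pos.1 (by rw [hA]; exact one_pos)
      have hj' := mem_nbrs.1 (Finset.mem_filter.1 hj).1
      obtain ⟨t, ht, h⟩ := hlink _ hj'
      exact ⟨t, ht, (Linked.single (gridAdj_add_dir u j) (by simp) (hsub hj')).trans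
        (h.mono hsub)⟩
    · obtain ⟨t, ht, h⟩ := hlink u hu
      exact ⟨t, ht, h.mono hsub⟩

theorem fewComponents_empty : FewComponents ∅ :=
  ⟨∅, subset_rfl, by simp [totalCurvature], by simp⟩

theorem fewComponents_singleton (v : Vertex) : FewComponents {v} := by
  refine ⟨{v}, subset_rfl, ?_, fun u hu => ⟨u, hu, .refl⟩⟩
  have := totalCurvature_insert (E := ∅) (v := v) (by simp)
  have h : nbrs ((∅ : Finset Vertex) : Set Vertex) v = ∅ := by ext; simp [mem_nbrs]
  rw [h] at this
  simpa [totalCurvature, arcEnds] using this.ge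

/-- A parallelogram with `m` full rows and `k` more vertices in the next row. -/
noncomputable def partialParallelogram (a : Vertex) (W m k : ℕ) : Finset Vertex :=
  Finset.Ico a.1 (a.1 + W) ×ˢ Finset.Ico a.2 (a.2 + m) ∪ Finset.Ico a.1 (a.1 + k) ×ˢ {a.2 + (m : ℤ)}

theorem mem_partialParallelogram {a : Vertex} {W m k : ℕ} {v : Vertex} :
    v ∈ partialParallelogram a W m k ↔
      (a.1 ≤ v.1 ∧ v.1 < a.1 + W) ∧ (a.2 ≤ v.2 ∧ v.2 < a.2 + m) ∨
        (a.1 ≤ v.1 ∧ v.1 < a.1 + k) ∧ v.2 = a.2 + m := by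
  simp only [partialParallelogram, Finset.mem_union, Finset.mem_product, Finset.mem_Ico,
    Finset.mem_singleton]

theorem partialParallelogram_succ (a : Vertex) (W m k : ℕ) :
    partialParallelogram a W m (k + 1) =
      insert (a.1 + (k : ℤ), a.2 + (m : ℤ)) (partialParallelogram a W m k) := by
  ext ⟨x, y⟩
  simp only [Finset.mem_insert, mem_partialParallelogram, Prod.mk.injEq]
  push_cast
  omega

/-- This is the situation when a parallelogram is filled row by row from left to right: nothing lies
to the right or in the next row. Direction 4 is occupied in all rows but the first, where only
direction 3 is. -/
theorem arcEnds_card_of_lower (A : Finset (Fin 6)) (h : 0 ∉ A ∧ 1 ∉ A ∧ 2 ∉ A)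
    (h' : 4 ∈ A ∨ 3 ∈ A ∧ 5 ∉ A) : (arcEnds A).card = 1 := by
  revert A; decide +kernel

theorem fewComponents_partialParallelogram (a : Vertex) (W m : ℕ) :
    ∀ k ≤ W, FewComponents (partialParallelogram a W m k) := by
  induction m with
  | zero =>
    intro k
    induction k with
    | zero =>
      intro _
      have : partialParallelogram a W 0 0 = ∅ := by simp [partialParallelogram]
      rw [this]; exact fewComponents_empty
    | succ k ih =>
      intro hk
      rcases Nat.eq_zero_or_pos k with rfl | hk'
      · have : partialParallelogram a W 0 (0 + 1) = {a} := by
          ext ⟨x, y⟩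
          simp only [mem_partialParallelogram, Finset.mem_singleton, Prod.ext_iff]
          push_cast
          omega
        rw [this]; exact fewComponents_singleton a
      · rw [partialParallelogram_succ]
        refine (ih (by omega)).insert ?_ (arcEnds_card_of_lower _ ?_ ?_)
        · simp [mem_partialParallelogram]
        · simp [mem_nbrs, mem_partialParallelogram, dir]
        · refine Or.inr ?_
          simp [mem_nbrs, mem_partialParallelogram, dir]
          omega
  | succ m ihm =>
    intro k
    induction k with
    | zero =>
      intro _
      have : partialParallelogram a W (m + 1) 0 = partialParallelogram a W m W := by
        ext ⟨x, y⟩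
        simp only [mem_partialParallelogram]
        push_cast
        omega
      rw [this]; exact ihm W le_rfl
    | succ k ih =>
      intro hk
      rw [partialParallelogram_succ]
      refine (ih (by omega)).insert ?_ (arcEnds_card_of_lower _ ?_ ?_)
      · simp [mem_partialParallelogram]
      · simp [mem_nbrs, mem_partialParallelogram, dir]
      · refine Or.inl ?_
        simp [mem_nbrs, mem_partialParallelogram, dir]
        omega

theorem exists_fewComponents_superset (E : Finset Vertex) : ∃ F, E ⊆ F ∧ FewComponents F := by
  obtain ⟨N, hN⟩ : ∃ N : ℕ, ∀ v ∈ E, v.1.natAbs ≤ N ∧ v.2.natAbs ≤ N := by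
    refine ⟨E.sup fun v => v.1.natAbs + v.2.natAbs, fun v hv => ?_⟩
    have := Finset.le_sup (f := fun v : Vertex => v.1.natAbs + v.2.natAbs) hv
    constructor <;> omega
  refine ⟨partialParallelogram (-(N : ℤ), -(N : ℤ)) (2 * N + 1) (2 * N + 1) 0, ?_,
    fewComponents_partialParallelogram _ _ _ _ (by omega)⟩
  intro v hv
  have := hN v hv
  rw [mem_partialParallelogram]
  push_cast
  omega

/-- A large parallelogram is peeled down to `E`. A path in the complement of `E` from a superfluous
vertex to the outside leaves the current set at a vertex that is not surrounded, and
`FewComponents.of_insert` allows its removal. The peeling is phrased as minimality of the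
cardinality of `F`. -/
theorem fewComponents_of_gridConnected_compl {E : Finset Vertex}
    (hE : GridConnected (E : Set Vertex)ᶜ) : FewComponents E := by
  classical
  let P : ℕ → Prop := fun k => ∃ F, E ⊆ F ∧ FewComponents F ∧ F.card = k
  have hP : ∃ k, P k := by
    obtain ⟨F, hF, hF'⟩ := exists_fewComponents_superset E
    exact ⟨_, F, hF, hF', rfl⟩
  obtain ⟨F, hEF, hF, hcard⟩ := Nat.find_spec hP
  by_cases hFE : F ⊆ E
  · rwa [subset_antisymm hEF hFE]
  obtain ⟨v, hvF, hvE⟩ := Finset.not_subset.1 hFE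
  obtain ⟨w, hw⟩ := Infinite.exists_notMem_finset F
  obtain ⟨a, b, hab, ha, hb, haF, hbF⟩ :=
    (hE v (by simpa using hvE) w (by simpa using fun h => hw (hEF h))).exists_exit
      (F := (F : Set Vertex)) hvF hw
  obtain ⟨i, rfl⟩ := hab
  have hins : insert a (F.erase a) = F := Finset.insert_erase haF
  have hlt : (F.erase a).card < Nat.find hP := hcard ▸ Finset.card_erase_lt_of_mem haF
  refine absurd ⟨F.erase a, fun u hu => Finset.mem_erase.2 ⟨?_, hEF hu⟩,
    FewComponents.of_insert (Finset.notMem_erase a F) (fun h => ?_) (by convert hF using 1), rfl⟩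
    (Nat.find_min hP hlt)
  · rintro rfl
    exact ha hu
  · have := mem_nbrs.1 (h.symm ▸ Finset.mem_univ i : i ∈ nbrs (F.erase a : Finset Vertex) a)
    exact hbF (Finset.mem_of_mem_erase this)

theorem six_le_totalCurvature {E : Finset Vertex} (hne : E.Nonempty)
    (hE : GridConnected (E : Set Vertex)ᶜ) : 6 ≤ totalCurvature E := by
  obtain ⟨T, _, hcard, hlink⟩ := fewComponents_of_gridConnected_compl hE
  obtain ⟨u, hu⟩ := hne
  obtain ⟨t, ht, _⟩ := hlink u hu
  have : 0 < T.card := Finset.card_pos.2 ⟨t, ht⟩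
  omega

/-! ### Existence of an unlocked corner -/

/-- A 3-corner vertex sends one unit of charge to each of its two end neighbors. -/
def sentCharge (A : Finset (Fin 6)) (j : Fin 6) : ℤ :=
  if A = {j, j + 1, j + 2} ∨ A = {j + 4, j + 5, j} then 1 else 0

/-- `i` belongs to an arc of length two. -/
def InShortArc (A : Finset (Fin 6)) (i : Fin 6) : Prop :=
  i + 1 ∈ A ∧ i + 2 ∉ A ∧ i + 5 ∉ A ∨ i + 5 ∈ A ∧ i + 4 ∉ A ∧ i + 1 ∉ A

instance (A : Finset (Fin 6)) (i : Fin 6) : Decidable (InShortArc A i) :=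
  inferInstanceAs (Decidable (_ ∨ _))

/-- Unless `A` is the full circle, which has curvature 0, the curvature is 6 minus the size minus
twice the number of arcs. A 3-corner has curvature 1, doubled so that each end neighbor can get one
unit, and keeps nothing. A short arc now occurs only beside another arc; then the doubled curvature
is -2 for lengths 1 and 2, and -4 for lengths 2 and 2, which pays for one unit per member of a short
arc. -/
theorem charge_nonpos (A : Finset (Fin 6))
    (h : cornerType A ≠ .corner 0 ∧ cornerType A ≠ .corner 1 ∧ cornerType A ≠ .corner 2) :
    2 * curvature A - ∑ j ∈ A, sentCharge A j +
      ∑ i ∈ A, (if InShortArc A i then 1 else 0 : ℤ) ≤ 0 := by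
  revert A; decide +kernel

theorem cornerType_three (i : Fin 6) : cornerType {i + 5, i, i + 1} = .corner 3 := by
  revert i; decide +kernel

theorem cornerType_three_eq {A : Finset (Fin 6)} (h : cornerType A = .corner 3) {i : Fin 6}
    (h1 : i ∈ A) (h2 : i + 1 ∈ A) (h3 : i + 2 ∈ A) : A = {i, i + 1, i + 2} := by
  revert A i; decide +kernel

/-- Reversal is an involution on the oriented edges inside `E`. -/
theorem sum_received_eq_sum_sent (E : Finset Vertex) (g : Vertex → Fin 6 → ℤ) :
    ∑ w ∈ E, ∑ i ∈ nbrs E w, g (w + dir i) (i + 3) = ∑ u ∈ E, ∑ j ∈ nbrs E u, g u j := by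
  rw [Finset.sum_sigma', Finset.sum_sigma']
  have h33 : ∀ i : Fin 6, i + 3 + 3 = i := by decide
  refine Finset.sum_bij' (fun x _ => ⟨x.1 + dir x.2, x.2 + 3⟩)
    (fun x _ => ⟨x.1 + dir x.2, x.2 + 3⟩) ?_ ?_ ?_ ?_ ?_
  · rintro ⟨w, i⟩ h
    rw [Finset.mem_sigma] at h ⊢
    exact ⟨mem_nbrs.1 h.2, add_three_mem_nbrs.2 h.1⟩
  · rintro ⟨w, i⟩ h
    rw [Finset.mem_sigma] at h ⊢
    exact ⟨mem_nbrs.1 h.2, add_three_mem_nbrs.2 h.1⟩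
  · rintro ⟨w, i⟩ _
    simp only [add_dir_add_dir_three, h33]
  · rintro ⟨w, i⟩ _
    simp only [add_dir_add_dir_three, h33]
  · rintro ⟨w, i⟩ _
    rfl

/-- Locked 3-corner vertices send charge only along arcs of length two. -/
theorem inShortArc_of_sentCharge {E : Set Vertex} (hlocked : ∀ v ∈ E, ∀ i,
    nbrs E v = {i + 5, i, i + 1} → cornerType (nbrs E (v + dir i)) = .corner 3)
    {w : Vertex} {i : Fin 6} (hw : w ∈ E) (hi : i ∈ nbrs E w)
    (hs : sentCharge (nbrs E (w + dir i)) (i + 3) ≠ 0) : InShortArc (nbrs E w) i := by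
  have hs' := (ite_ne_right_iff.1 hs).1
  have hp : w + dir i ∈ E := mem_nbrs.1 hi
  rcases hs' with h | h
  · obtain ⟨h2, h4, h5, hB⟩ : i + 2 ∉ nbrs E (w + dir i) ∧ i + 4 ∈ nbrs E (w + dir i) ∧
        i + 5 ∈ nbrs E (w + dir i) ∧ nbrs E (w + dir i) = {i + 4 + 5, i + 4, i + 4 + 1} := by
      rw [h]; clear * -; revert i; decide
    -- The middle neighbor of the sender `w + dir i` is also a neighbor of `w`. It sees the other
    -- end neighbor, the sender and `w` consecutively, so as a 3-corner it has no further neighbor;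
    -- this stops the arc of `w` right behind it. On the other side the arc stops because the sender
    -- has no further neighbor.
    have hm := hlocked _ hp (i + 4) hB
    rw [add_dir_add_dir_four] at hm
    have h0 : i ∈ nbrs E (w + dir (i + 5)) := by
      have := (add_two_mem_nbrs (E := E) (i := i + 4) (v := w + dir i)).2
        (by rwa [add_assoc i 4 1])
      rwa [add_dir_add_dir_four, add_assoc i 4 2, show (4 + 2 : Fin 6) = 0 from rfl,
        add_zero] at this
    have h1 : i + 1 ∈ nbrs E (w + dir (i + 5)) := by
      have := (add_two_mem_nbrs (E := E) (i := i + 5) (v := w)).2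
        (by rwa [add_assoc i 5 1, show (5 + 1 : Fin 6) = 0 from rfl, add_zero])
      rwa [add_assoc i 5 2] at this
    have h2' : i + 2 ∈ nbrs E (w + dir (i + 5)) := by
      have := (add_three_mem_nbrs (i := i + 5) (v := w)).2 hw
      rwa [add_assoc i 5 3] at this
    have hC := cornerType_three_eq hm h0 h1 h2'
    refine Or.inr ⟨add_four_mem_nbrs.1 h4, fun hc => ?_, fun hc => h2 (add_two_mem_nbrs.2 hc)⟩
    have := (add_four_mem_nbrs (E := E) (i := i + 5) (v := w)).2 (by rwa [add_assoc i 5 5])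
    rw [hC, add_assoc i 5 4] at this
    clear * - this; revert i; decide
  · obtain ⟨h4, h2, h1, hB⟩ : i + 4 ∉ nbrs E (w + dir i) ∧ i + 2 ∈ nbrs E (w + dir i) ∧
        i + 1 ∈ nbrs E (w + dir i) ∧ nbrs E (w + dir i) = {i + 2 + 5, i + 2, i + 2 + 1} := by
      rw [h]; clear * -; revert i; decide
    have hm := hlocked _ hp (i + 2) hB
    rw [add_dir_add_dir_two] at hm
    have h0 : i ∈ nbrs E (w + dir (i + 1)) := by
      have := (add_four_mem_nbrs (E := E) (i := i + 2) (v := w + dir i)).2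
        (by rwa [add_assoc i 2 5])
      rwa [add_dir_add_dir_two, add_assoc i 2 4, show (2 + 4 : Fin 6) = 0 from rfl,
        add_zero] at this
    have h5 : i + 5 ∈ nbrs E (w + dir (i + 1)) := by
      have := (add_four_mem_nbrs (E := E) (i := i + 1) (v := w)).2
        (by rwa [add_assoc i 1 5, show (1 + 5 : Fin 6) = 0 from rfl, add_zero])
      rwa [add_assoc i 1 4] at this
    have h4' : i + 4 ∈ nbrs E (w + dir (i + 1)) := by
      have := (add_three_mem_nbrs (i := i + 1) (v := w)).2 hw
      rwa [add_assoc i 1 3] at this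
    have hC := cornerType_three_eq (i := i + 4) hm h4' (by rwa [add_assoc i 4 1])
      (by rwa [add_assoc i 4 2, show (4 + 2 : Fin 6) = 0 from rfl, add_zero])
    refine Or.inl ⟨add_two_mem_nbrs.1 h2, fun hc => ?_, fun hc => h4 (add_four_mem_nbrs.2 hc)⟩
    have := (add_two_mem_nbrs (E := E) (i := i + 1) (v := w)).2 (by rwa [add_assoc i 1 1])
    rw [hC, add_assoc i 1 2] at this
    clear * - this; revert i; decide

/-- A nonempty finite set without holes has a corner vertex that is not locked. -/
theorem exists_unlocked_corner {E : Finset Vertex} (hne : E.Nonempty)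
    (hE : GridConnected (E : Set Vertex)ᶜ) : ∃ v ∈ E,
      cornerType (nbrs E v) = .corner 0 ∨ cornerType (nbrs E v) = .corner 1 ∨
      cornerType (nbrs E v) = .corner 2 ∨ ∃ i, nbrs E v = {i + 5, i, i + 1} ∧
        cornerType (nbrs E (v + dir i)) ≠ .corner 3 := by
  by_contra! hno
  have h6 := six_le_totalCurvature hne hE
  -- Charge is only moved around, so its total is still at least 12, although no vertex retains a
  -- positive amount.
  have hsum := sum_received_eq_sum_sent E fun u j => sentCharge (nbrs E u) j
  have hle : ∑ w ∈ E, (2 * curvature (nbrs E w) - ∑ j ∈ nbrs E w, sentCharge (nbrs E w) j +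
      ∑ i ∈ nbrs E w, sentCharge (nbrs E (w + dir i)) (i + 3)) ≤ 0 := by
    refine Finset.sum_nonpos fun w hw => ?_
    obtain ⟨h0, h1, h2, _⟩ := hno w hw
    refine le_trans (add_le_add_right (Finset.sum_le_sum fun i hi => ?_) _)
      (charge_nonpos (nbrs E w) ⟨h0, h1, h2⟩)
    by_cases hs : sentCharge (nbrs (E : Set Vertex) (w + dir i)) (i + 3) = 0
    · rw [hs]; split_ifs <;> norm_num
    · rw [if_pos (inShortArc_of_sentCharge (fun v hv i => (hno v hv).2.2.2 i) hw hi hs)]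
      unfold sentCharge; split_ifs <;> norm_num
  rw [Finset.sum_add_distrib, Finset.sum_sub_distrib, hsum, ← Finset.mul_sum] at hle
  rw [totalCurvature] at h6
  linarith

/-! ### Simultaneous elimination -/

/-- The vertex `v` of `E` has a neighbor in `E`, but not in `D`, that is adjacent to all other
neighbors of `v` in `E`. -/
def Dominated (E D : Set Vertex) (v : Vertex) : Prop :=
  ∃ i ∈ nbrs E v, v + dir i ∉ D ∧ nbrs E v ⊆ {i + 5, i, i + 1}

theorem eq_or_gridAdj_of_nbrs_subset {E : Set Vertex} {v : Vertex} {i j : Fin 6}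
    (hA : nbrs E v ⊆ {i + 5, i, i + 1}) (hj : j ∈ nbrs E v) :
    v + dir j = v + dir i ∨ GridAdj (v + dir j) (v + dir i) := by
  have := hA hj
  simp only [Finset.mem_insert, Finset.mem_singleton] at this
  rcases this with rfl | rfl | rfl
  · refine Or.inr (gridAdj_dir_dir (Or.inl ?_) v)
    clear * -; revert i; decide
  · exact Or.inl rfl
  · exact Or.inr (gridAdj_dir_dir (Or.inr rfl) v)

/-- Mapping each vertex of `D` to a dominating neighbor and fixing the others takes adjacent
vertices to equal or adjacent ones. This retraction therefore carries paths of `E` to paths that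
avoid `D`. -/
theorem GridConnected.diff {E D : Set Vertex} (hE : GridConnected E)
    (hD : ∀ v ∈ D, Dominated E D v) : GridConnected (E \ D) := by
  classical
  have hex : ∀ v ∈ E, ∃ w ∈ E \ D, (v ∉ D → w = v) ∧
      (v ∈ D → GridAdj v w ∧ ∀ u ∈ E, GridAdj v u → u = w ∨ GridAdj u w) := by
    intro v hv
    by_cases hvD : v ∈ D
    · obtain ⟨i, hi, hiD, hA⟩ := hD v hvD
      refine ⟨v + dir i, ⟨mem_nbrs.1 hi, hiD⟩, fun h => absurd hvD h,
        fun _ => ⟨gridAdj_add_dir v i, ?_⟩⟩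
      rintro _ hu ⟨j, rfl⟩
      exact eq_or_gridAdj_of_nbrs_subset hA (mem_nbrs.2 hu)
    · exact ⟨v, ⟨hv, hvD⟩, fun _ => rfl, fun h => absurd h hvD⟩
  choose! r hr hr1 hr2 using hex
  have hadj : ∀ a ∈ E, ∀ b ∈ E, a = b ∨ GridAdj a b → a ∉ D → b ∉ D →
      Linked (E \ D) a b := by
    rintro a ha b hb (rfl | h) haD hbD
    · exact .refl
    · exact .single h ⟨ha, haD⟩ ⟨hb, hbD⟩
  have hstep : ∀ a ∈ E, ∀ b ∈ E, GridAdj a b → Linked (E \ D) (r a) (r b) := by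
    intro a ha b hb h
    by_cases haD : a ∈ D
    · by_cases hbD : b ∈ D
      -- Domination is used twice: at `a` it makes the survivor `r a` a neighbor of `b`, and then at
      -- `b` it makes `r a` equal or adjacent to `r b`.
      · have h1 := (hr2 a ha haD).2 b hb h
        have hne : b ≠ r a := fun h' => (hr a ha).2 (h' ▸ hbD)
        have h2 := (hr2 b hb hbD).2 (r a) (hr a ha).1 (h1.resolve_left hne)
        exact hadj _ (hr a ha).1 _ (hr b hb).1 h2 (hr a ha).2 (hr b hb).2
      · rw [hr1 b hb hbD]
        refine (hadj _ hb _ (hr a ha).1 ((hr2 a ha haD).2 b hb h) hbD (hr a ha).2).symm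
    · rw [hr1 a ha haD]
      by_cases hbD : b ∈ D
      · exact hadj _ ha _ (hr b hb).1 ((hr2 b hb hbD).2 a ha h.symm) haD (hr b hb).2
      · rw [hr1 b hb hbD]
        exact hadj _ ha _ hb (Or.inr h) haD hbD
  intro u hu v hv
  have : ∀ w, Linked E u w → Linked (E \ D) (r u) (r w) := by
    intro w h
    induction h with
    | refl => exact .refl
    | tail _ h ih => exact ih.trans (hstep _ h.2.1 _ h.2.2 h.1)
  have h := this v (hE u hu.1 v hv.1)
  rwa [hr1 u hu.1 hu.2, hr1 v hv.1 hv.2] at h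

/-- The vertex opposite to a dominating neighbor does not belong to `E`, so each removed vertex is
attached to the old complement. -/
theorem GridConnected.compl_diff {E D : Set Vertex} (hE : GridConnected Eᶜ)
    (hD : ∀ v ∈ D, Dominated E D v) : GridConnected (E \ D)ᶜ := by
  have hsub : Eᶜ ⊆ (E \ D)ᶜ := Set.compl_subset_compl.2 Set.sdiff_subset
  have hex : ∀ v ∈ (E \ D)ᶜ, ∃ w ∈ Eᶜ, Linked (E \ D)ᶜ v w := by
    intro v hv
    by_cases hvE : v ∈ E
    · have hvD : v ∈ D := by by_contra h; exact hv ⟨hvE, h⟩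
      obtain ⟨i, _, _, hA⟩ := hD v hvD
      have h3 : v + dir (i + 3) ∈ Eᶜ := fun h => by
        have := hA (mem_nbrs.2 h)
        clear * - this; revert i; decide
      exact ⟨_, h3, .single (gridAdj_add_dir v _) hv (hsub h3)⟩
    · exact ⟨v, hvE, .refl⟩
  intro u hu v hv
  obtain ⟨u', hu', h1⟩ := hex u hu
  obtain ⟨v', hv', h2⟩ := hex v hv
  exact (h1.trans ((hE u' hu' v' hv').mono hsub)).trans h2.symm

theorem Dominated.diff_nonempty {E D : Set Vertex} (hne : E.Nonempty)
    (hD : ∀ v ∈ D, Dominated E D v) : (E \ D).Nonempty := by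
  obtain ⟨v, hv⟩ := hne
  by_cases hvD : v ∈ D
  · obtain ⟨i, hi, hiD, _⟩ := hD v hvD
    exact ⟨_, mem_nbrs.1 hi, hiD⟩
  · exact ⟨v, hv, hvD⟩

/-- The vertex `v` of `E` passes the test for its elimination, provided that it is not misled
about the corner types of those of its neighbors that belong to `D`. -/
inductive Eliminable (E D : Set Vertex) (v : Vertex) : Prop
  | one (h : cornerType (nbrs E v) = .corner 1) (h' : ∃ i ∈ nbrs E v, v + dir i ∈ D →
      cornerType (nbrs E (v + dir i)) ≠ .corner 1)
  | two (h : cornerType (nbrs E v) = .corner 2) (h' : ∃ i ∈ nbrs E v, v + dir i ∈ D →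
      cornerType (nbrs E (v + dir i)) ≠ .corner 2)
  | three (h : cornerType (nbrs E v) = .corner 3) (h' : ∀ i, nbrs E v = {i + 5, i, i + 1} →
      v + dir i ∈ D → cornerType (nbrs E (v + dir i)) ≠ .corner 3)

/-- The vertex has corner type 1, 2 or 3. -/
def IsProperCorner (A : Finset (Fin 6)) : Prop :=
  cornerType A = .corner 1 ∨ cornerType A = .corner 2 ∨ cornerType A = .corner 3

instance (A : Finset (Fin 6)) : Decidable (IsProperCorner A) :=
  inferInstanceAs (Decidable (_ ∨ _))

theorem Eliminable.isProperCorner {E D : Set Vertex} {v : Vertex} (h : Eliminable E D v) :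
    IsProperCorner (nbrs E v) := by
  rcases h with ⟨h, _⟩ | ⟨h, _⟩ | ⟨h, _⟩ <;> simp [IsProperCorner, h]

theorem eq_of_cornerType_one {A : Finset (Fin 6)} (h : cornerType A = .corner 1) {i : Fin 6}
    (hi : i ∈ A) : A = {i} := by
  revert A i; decide +kernel

theorem eq_of_cornerType_two {A : Finset (Fin 6)} (h : cornerType A = .corner 2) {i : Fin 6}
    (hi : i ∈ A) : A = {i, i + 1} ∨ A = {i, i + 5} := by
  revert A i; decide +kernel

theorem exists_of_cornerType_three {A : Finset (Fin 6)} (h : cornerType A = .corner 3) :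
    ∃ i, A = {i + 5, i, i + 1} := by
  revert A; decide +kernel

/-- Here and in the two `cornerType_end` lemmas, `A` is to be thought of as the neighborhood of `v +
dir i`: direction `i + 3` leads back to `v`, and `i + 2`, `i + 4` lead to the common neighbors of
both. -/
theorem cornerType_one_of_isolated {A : Finset (Fin 6)} (h : IsProperCorner A) {i : Fin 6}
    (h3 : i + 3 ∈ A) (h2 : i + 2 ∉ A) (h4 : i + 4 ∉ A) : cornerType A = .corner 1 := by
  revert A i; decide +kernel

theorem cornerType_three_of_consecutive {A : Finset (Fin 6)} (h : IsProperCorner A) {i : Fin 6}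
    (h0 : i ∈ A) (h1 : i + 1 ∈ A) (h2 : i + 2 ∈ A) : cornerType A = .corner 3 := by
  revert A i; decide +kernel

theorem cornerType_end_right {A : Finset (Fin 6)} (h : IsProperCorner A)
    (hA2 : cornerType A ≠ .corner 2) {i : Fin 6} (h3 : i + 3 ∈ A) (h2 : i + 2 ∈ A)
    (h4 : i + 4 ∉ A) : cornerType A = .corner 3 ∧ A = {i + 2 + 5, i + 2, i + 2 + 1} := by
  revert A i; decide +kernel

theorem cornerType_end_left {A : Finset (Fin 6)} (h : IsProperCorner A)
    (hA2 : cornerType A ≠ .corner 2) {i : Fin 6} (h3 : i + 3 ∈ A) (h2 : i + 2 ∉ A)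
    (h4 : i + 4 ∈ A) : cornerType A = .corner 3 ∧ A = {i + 4 + 5, i + 4, i + 4 + 1} := by
  revert A i; decide +kernel

/-- Members of `D` are proper corners, which leaves little choice for their types. For a 1-corner or
3-corner `v`, the only or the middle neighbor dominates; if it were in `D`, it would have the same
type as `v`, which the test rules out. For a 2-corner `v`, let `q` be the neighbor that is not a
2-corner. If `q` is in `D`, it must be a 3-corner, and its middle neighbor is the other neighbor `r`
of `v`. If `r` were in `D` as well, its three consecutive neighbors would make it a 3-corner, so
that `q` would be locked. Hence `q` or `r` survives. -/
theorem Eliminable.dominated {E D : Set Vertex} (hDE : D ⊆ E) (hD : ∀ v ∈ D, Eliminable E D v)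
    {v : Vertex} (hv : v ∈ D) : Dominated E D v := by
  have hcorner : ∀ {i}, v + dir i ∈ D → IsProperCorner (nbrs E (v + dir i)) := fun h =>
    (hD _ h).isProperCorner
  have h3 : ∀ i, i + 3 ∈ nbrs E (v + dir i) := fun i => add_three_mem_nbrs.2 (hDE hv)
  rcases hD v hv with ⟨h, i, hi, hiD⟩ | ⟨h, i, hi, hiD⟩ | ⟨h, hiD⟩
  · have hA := eq_of_cornerType_one h hi
    refine ⟨i, hi, fun hD' => hiD hD' ?_, by rw [hA]; simp⟩
    refine cornerType_one_of_isolated (hcorner hD') (h3 i) ?_ ?_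
    · rw [add_two_mem_nbrs, hA]; clear * -; revert i; decide
    · rw [add_four_mem_nbrs, hA]; clear * -; revert i; decide
  · by_cases hD' : v + dir i ∈ D
    · rcases eq_of_cornerType_two h hi with hA | hA
      · refine ⟨i + 1, by simp [hA], fun hr => ?_, ?_⟩
        · obtain ⟨g, hB⟩ := cornerType_end_right (hcorner hD') (hiD hD') (h3 i)
            (by rw [add_two_mem_nbrs, hA]; simp)
            (by rw [add_four_mem_nbrs, hA]; clear * -; revert i; decide)
          rcases hD _ hD' with ⟨h', _⟩ | ⟨h', _⟩ | ⟨_, hlock⟩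
          · rw [g] at h'; exact absurd h' (by decide)
          · rw [g] at h'; exact absurd h' (by decide)
          · have := hlock (i + 2) hB (by rwa [add_dir_add_dir_two])
            rw [add_dir_add_dir_two] at this
            refine this (cornerType_three_of_consecutive (hcorner hr) (i := i + 4) ?_ ?_ ?_)
            · have := h3 (i + 1)
              rwa [add_assoc i 1 3] at this
            · have := (add_four_mem_nbrs (E := E) (i := i + 1) (v := v)).2
                (by rwa [add_assoc i 1 5, show (1 + 5 : Fin 6) = 0 from rfl, add_zero])
              rwa [add_assoc i 1 4, ← show i + 4 + 1 = i + (1 + 4) from add_assoc i 4 1] at this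
            · have := (add_four_mem_nbrs (E := E) (i := i + 2) (v := v + dir i)).2
                (by rw [hB]; simp)
              rwa [add_dir_add_dir_two, add_assoc i 2 4,
                ← show i + 4 + 2 = i + (2 + 4) from add_assoc i 4 2] at this
        · rw [hA]; clear * -; revert i; decide
      · refine ⟨i + 5, by simp [hA], fun hr => ?_, ?_⟩
        · obtain ⟨g, hB⟩ := cornerType_end_left (hcorner hD') (hiD hD') (h3 i)
            (by rw [add_two_mem_nbrs, hA]; clear * -; revert i; decide)
            (by rw [add_four_mem_nbrs, hA]; simp)
          rcases hD _ hD' with ⟨h', _⟩ | ⟨h', _⟩ | ⟨_, hlock⟩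
          · rw [g] at h'; exact absurd h' (by decide)
          · rw [g] at h'; exact absurd h' (by decide)
          · have := hlock (i + 4) hB (by rwa [add_dir_add_dir_four])
            rw [add_dir_add_dir_four] at this
            refine this (cornerType_three_of_consecutive (hcorner hr) (i := i) ?_ ?_ ?_)
            · have := (add_two_mem_nbrs (E := E) (i := i + 4) (v := v + dir i)).2
                (by rw [hB]; simp)
              rwa [add_dir_add_dir_four, add_assoc i 4 2, show (4 + 2 : Fin 6) = 0 from rfl,
                add_zero] at this
            · have := (add_two_mem_nbrs (E := E) (i := i + 5) (v := v)).2
                (by rwa [add_assoc i 5 1, show (5 + 1 : Fin 6) = 0 from rfl, add_zero])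
              rwa [add_assoc i 5 2] at this
            · have := h3 (i + 5)
              rwa [add_assoc i 5 3] at this
        · rw [hA]; clear * -; revert i; decide
    · refine ⟨i, hi, hD', ?_⟩
      rcases eq_of_cornerType_two h hi with hA | hA <;> rw [hA] <;> clear * - <;> revert i <;>
        decide
  · obtain ⟨i, hA⟩ := exists_of_cornerType_three h
    refine ⟨i, by simp [hA], fun hD' => hiD i hA hD' ?_, by rw [hA]⟩
    refine cornerType_three_of_consecutive (hcorner hD') (i := i + 2) ?_ ?_ ?_
    · rw [add_two_mem_nbrs, hA]; simp
    · rw [add_assoc i 2 1]; exact h3 i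
    · rw [add_assoc i 2 2, show (2 + 2 : Fin 6) = 4 from rfl, add_four_mem_nbrs, hA]; simp

/-! ### Hexagonal stars in the plane -/

/-- Coefficients of the six linear forms that are at most 1 on the hexagon around the origin. -/
def hexCoeff : Fin 6 → ℤ × ℤ := ![(1, 0), (1, 1), (0, 1), (-1, 0), (-1, -1), (0, -1)]

def hexForm (m : Fin 6) (v : Vertex) : ℤ := (hexCoeff m).1 * v.1 + (hexCoeff m).2 * v.2

/-- The two parentheses that depend on `p` are its coordinates in the lattice basis. -/
noncomputable def planeForm (m : Fin 6) (p : Plane) : ℝ :=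
  (hexCoeff m).1 * (p 0 - p 1 / Real.sqrt 3) + (hexCoeff m).2 * (2 * p 1 / Real.sqrt 3)

theorem planeForm_point (m : Fin 6) (v : Vertex) : planeForm m (point v) = hexForm m v := by
  have h3 : Real.sqrt 3 ≠ 0 := by positivity
  simp only [planeForm, point, hexForm, PiLp.toLp_apply, Matrix.cons_val_zero,
    Matrix.cons_val_one, Int.cast_add, Int.cast_mul]
  field_simp
  ring

theorem planeForm_add (m : Fin 6) (p q : Plane) :
    planeForm m (p + q) = planeForm m p + planeForm m q := by
  simp only [planeForm, PiLp.add_apply]; ring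

theorem planeForm_smul (m : Fin 6) (r : ℝ) (p : Plane) :
    planeForm m (r • p) = r * planeForm m p := by
  simp only [planeForm, PiLp.smul_apply, smul_eq_mul]; ring

theorem continuous_planeForm (m : Fin 6) : Continuous (planeForm m) := by
  unfold planeForm; fun_prop

theorem hexForm_sub (m : Fin 6) (u v : Vertex) : hexForm m (u - v) = hexForm m u - hexForm m v := by
  simp only [hexForm, Prod.fst_sub, Prod.snd_sub]; ring

theorem hexForm_add_three (m : Fin 6) (v : Vertex) : hexForm (m + 3) v = -hexForm m v := by
  fin_cases m <;> simp [hexForm, hexCoeff] <;> ring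

theorem planeForm_add_three (m : Fin 6) (p : Plane) : planeForm (m + 3) p = -planeForm m p := by
  fin_cases m <;> simp [planeForm, hexCoeff] <;> ring

/-- Equal or adjacent. -/
def Near (u v : Vertex) : Prop := ∀ m, hexForm m (u - v) ≤ 1

theorem hexForm_le_one_iff {v : Vertex} : (∀ m, hexForm m v ≤ 1) ↔ v = 0 ∨ ∃ i, v = dir i := by
  constructor
  · intro h
    obtain ⟨x, y⟩ := v
    have h0 := h 0
    have h1 := h 1
    have h2 := h 2
    have h3 := h 3
    have h4 := h 4
    have h5 := h 5
    simp [hexForm, hexCoeff] at h0 h1 h2 h3 h4 h5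
    have hx : x = -1 ∨ x = 0 ∨ x = 1 := by omega
    have hy : y = -1 ∨ y = 0 ∨ y = 1 := by omega
    rcases hx with rfl | rfl | rfl <;> rcases hy with rfl | rfl | rfl <;>
      first | omega | decide
  · rintro (rfl | ⟨i, rfl⟩)
    · decide
    · revert i; decide

theorem near_iff {u v : Vertex} : Near u v ↔ u = v ∨ GridAdj v u := by
  rw [Near, hexForm_le_one_iff, sub_eq_zero]
  refine or_congr Iff.rfl (exists_congr fun i => ?_)
  rw [sub_eq_iff_eq_add, add_comm]

theorem Near.refl (u : Vertex) : Near u u := near_iff.2 (Or.inl rfl)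

theorem GridAdj.near {u v : Vertex} (h : GridAdj u v) : Near u v := near_iff.2 (Or.inr h.symm)

theorem Near.symm {u v : Vertex} (h : Near u v) : Near v u := by
  rcases near_iff.1 h with rfl | h
  · exact .refl _
  · exact h.near

/-- The open hexagon around a vertex. -/
def openStar (v : Vertex) : Set Plane := {p | ∀ m, planeForm m p - hexForm m v < 1}

theorem isOpen_openStar (v : Vertex) : IsOpen (openStar v) := by
  rw [openStar, Set.ofPred_forall]
  exact isOpen_iInter_of_finite fun m =>
    isOpen_lt ((continuous_planeForm m).sub continuous_const) continuous_const

theorem convex_openStar (v : Vertex) : Convex ℝ (openStar v) := by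
  intro p hp q hq a b ha hb hab m
  rw [planeForm_add, planeForm_smul, planeForm_smul]
  have h1 := hp m
  have h2 := hq m
  obtain rfl : b = 1 - a := by linarith
  rcases ha.eq_or_lt with rfl | ha
  · linarith
  · nlinarith

theorem point_mem_openStar (v : Vertex) : point v ∈ openStar v := by
  intro m; rw [planeForm_point]; simp

/-- Opposite forms bound the difference of the values at `u` and `v` strictly by 2, and these values
are integers. -/
theorem near_of_openStar {u v : Vertex} {p : Plane} (hu : p ∈ openStar u) (hv : p ∈ openStar v) :
    Near u v := by
  intro m
  have h1 := hv m
  have h2 := hu (m + 3)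
  rw [planeForm_add_three, hexForm_add_three] at h2
  rw [hexForm_sub]
  push_cast at h2
  have : ((hexForm m u - hexForm m v : ℤ) : ℝ) < (2 : ℤ) := by push_cast; linarith
  have := Int.cast_lt.1 this
  omega

theorem eq_of_point_mem_openStar {u v : Vertex} (h : point u ∈ openStar v) : u = v := by
  rcases near_iff.1 (near_of_openStar (point_mem_openStar u) h) with h' | ⟨i, rfl⟩
  · exact h'
  · exfalso
    have hi : ∃ m, hexForm m (dir i) = 1 := by clear h; revert i; decide
    obtain ⟨m, hm⟩ := hi
    have := h m
    rw [planeForm_point, ← Int.cast_sub, ← hexForm_sub, add_sub_cancel_left, hm] at this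
    norm_num at this

/-! ### Cells -/

/-- The convex hull of three vertices. -/
noncomputable def hull (a b c : Vertex) : Set Plane := convexHull ℝ {point a, point b, point c}

theorem mem_hull {a b c : Vertex} {p : Plane} : p ∈ hull a b c ↔ ∃ α β γ : ℝ,
    0 ≤ α ∧ 0 ≤ β ∧ 0 ≤ γ ∧ α + β + γ = 1 ∧ p = α • point a + β • point b + γ • point c := by
  constructor
  · rw [hull, convexHull_insert (by simp), convexHull_pair, mem_convexJoin]
    rintro ⟨_, rfl, q, ⟨s, t, hs, ht, hst, rfl⟩, ⟨x, y, hx, hy, hxy, rfl⟩⟩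
    refine ⟨x, y * s, y * t, hx, by positivity, by positivity, ?_, ?_⟩
    · rw [add_assoc, ← mul_add, hst, mul_one, hxy]
    · rw [smul_add, smul_smul, smul_smul, add_assoc]
  · rintro ⟨α, β, γ, ha, hb, hc, h, rfl⟩
    have := (convex_convexHull ℝ {point a, point b, point c}).sum_mem (t := Finset.univ)
      (w := ![α, β, γ]) (z := ![point a, point b, point c])
      (by intro i _; fin_cases i <;> assumption) (by simpa [Fin.sum_univ_three] using h)
      (by
        intro i _
        refine subset_convexHull ℝ _ ?_
        fin_cases i <;> simp)
    simpa [hull, Fin.sum_univ_three] using this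

/-- Three vertices of a common face. -/
def Clique3 (a b c : Vertex) : Prop := Near a b ∧ Near b c ∧ Near a c

theorem hull_pair (a b : Vertex) : hull a b b = segment ℝ (point a) (point b) := by
  rw [hull, Set.pair_eq_singleton, convexHull_pair]

theorem hull_singleton (a : Vertex) : hull a a a = {point a} := by
  rw [hull_pair, segment_same]

/-- Repetitions among the three vertices are allowed, which makes it possible to treat all kinds of
cells alike. -/
theorem IsCell.exists_eq_hull {C : Set Plane} (h : IsCell C) :
    ∃ a b c, Clique3 a b c ∧ C = hull a b c := by
  cases h with
  | vertex u => exact ⟨u, u, u, ⟨.refl u, .refl u, .refl u⟩, (hull_singleton u).symm⟩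
  | edge u i => exact ⟨u, u + dir i, u + dir i, ⟨(gridAdj_add_dir u i).near, .refl _,
      (gridAdj_add_dir u i).near⟩, (hull_pair _ _).symm⟩
  | face u i => exact ⟨u, u + dir i, u + dir (i + 1), ⟨(gridAdj_add_dir u i).near,
      (gridAdj_dir_dir (Or.inl rfl) u).near, (gridAdj_add_dir u _).near⟩, rfl⟩

theorem Clique3.isCell {a b c : Vertex} (h : Clique3 a b c) : IsCell (hull a b c) := by
  obtain ⟨h1, h2, h3⟩ := h
  rcases near_iff.1 h1.symm with rfl | ⟨i, rfl⟩
  · rcases near_iff.1 h2.symm with rfl | ⟨i, rfl⟩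
    · rw [hull_singleton]; exact .vertex _
    · have : hull b b (b + dir i) = segment ℝ (point b) (point (b + dir i)) := by
        rw [hull, Set.insert_eq_of_mem (by simp), convexHull_pair]
      rw [this]; exact .edge b i
  · rcases near_iff.1 h3.symm with rfl | ⟨j, rfl⟩
    · have : hull c (c + dir i) c = segment ℝ (point c) (point (c + dir i)) := by
        rw [hull, Set.pair_comm, Set.insert_eq_of_mem (by simp), convexHull_pair]
      rw [this]; exact .edge c i
    · rcases near_iff.1 h2.symm with h | h
      · rw [h, hull_pair]; exact .edge a i
      · rcases gridAdj_add_dir_iff.1 h with rfl | rfl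
        · exact .face a i
        · rw [hull, Set.pair_comm]; exact .face a j

theorem planeForm_combination (m : Fin 6) (a b c : Vertex) (α β γ : ℝ) :
    planeForm m (α • point a + β • point b + γ • point c) =
      α * hexForm m a + β * hexForm m b + γ * hexForm m c := by
  simp only [planeForm_add, planeForm_smul, planeForm_point]

theorem Near.cast_le {u v : Vertex} (h : Near u v) (m : Fin 6) :
    (hexForm m u : ℝ) - hexForm m v ≤ 1 := by
  have := h m
  rw [hexForm_sub] at this
  exact_mod_cast this

theorem mem_openStar_of_pos {a b c : Vertex} {α β γ : ℝ} (hb : Near b a) (hc : Near c a)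
    (hα : 0 < α) (hβ : 0 ≤ β) (hγ : 0 ≤ γ) (hsum : α + β + γ = 1) :
    α • point a + β • point b + γ • point c ∈ openStar a := by
  intro m
  rw [planeForm_combination]
  have h1 := mul_le_mul_of_nonneg_left (hb.cast_le m) hβ
  have h2 := mul_le_mul_of_nonneg_left (hc.cast_le m) hγ
  obtain rfl : α = 1 - β - γ := by linarith
  linarith

/-- One of the six forms separates the open hexagon around the origin from a cell that does not have
the origin as a vertex. If a form is at least 2 at one vertex, nearness makes it at least 1 at the
others; otherwise all three are unit directions, and finitely many cases remain. -/
theorem exists_hexForm_pos {a b c : Vertex} (h : Clique3 a b c) (ha : a ≠ 0) (hb : b ≠ 0)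
    (hc : c ≠ 0) : ∃ m, 1 ≤ hexForm m a ∧ 1 ≤ hexForm m b ∧ 1 ≤ hexForm m c := by
  by_cases hbig : ∃ m, 2 ≤ hexForm m a ∨ 2 ≤ hexForm m b ∨ 2 ≤ hexForm m c
  · obtain ⟨m, hm⟩ := hbig
    refine ⟨m, ?_⟩
    have h1 := h.1 m
    have h2 := h.2.1 m
    have h3 := h.2.2 m
    have h1' := h.1.symm m
    have h2' := h.2.1.symm m
    have h3' := h.2.2.symm m
    rw [hexForm_sub] at h1 h2 h3 h1' h2' h3'
    omega
  · push Not at hbig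
    obtain ⟨i, rfl⟩ := (hexForm_le_one_iff.1 fun m =>
      Int.lt_add_one_iff.1 (hbig m).1).resolve_left ha
    obtain ⟨j, rfl⟩ := (hexForm_le_one_iff.1 fun m =>
      Int.lt_add_one_iff.1 (hbig m).2.1).resolve_left hb
    obtain ⟨k, rfl⟩ := (hexForm_le_one_iff.1 fun m =>
      Int.lt_add_one_iff.1 (hbig m).2.2).resolve_left hc
    clear hbig ha hb hc
    simp only [Clique3, Near] at h
    revert i j k
    decide +kernel

theorem eq_of_mem_openStar_of_mem_hull {a b c v : Vertex} {p : Plane} (h : Clique3 a b c)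
    (hp : p ∈ hull a b c) (hv : p ∈ openStar v) : v = a ∨ v = b ∨ v = c := by
  by_contra! hne
  obtain ⟨α, β, γ, hα, hβ, hγ, hsum, rfl⟩ := mem_hull.1 hp
  have hshift : ∀ u w : Vertex, Near u w → Near (u - v) (w - v) := fun u w h m => by
    have := h m
    rwa [sub_sub_sub_cancel_right]
  obtain ⟨m, h1, h2, h3⟩ := exists_hexForm_pos
    ⟨hshift _ _ h.1, hshift _ _ h.2.1, hshift _ _ h.2.2⟩ (sub_ne_zero.2 hne.1.symm)
    (sub_ne_zero.2 hne.2.1.symm) (sub_ne_zero.2 hne.2.2.symm)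
  have hm := hv m
  rw [planeForm_combination] at hm
  rw [hexForm_sub] at h1 h2 h3
  have h1' : (1 : ℝ) ≤ hexForm m a - hexForm m v := by exact_mod_cast h1
  have h2' : (1 : ℝ) ≤ hexForm m b - hexForm m v := by exact_mod_cast h2
  have h3' : (1 : ℝ) ≤ hexForm m c - hexForm m v := by exact_mod_cast h3
  have g1 := mul_le_mul_of_nonneg_left h1' hα
  have g2 := mul_le_mul_of_nonneg_left h2' hβ
  have g3 := mul_le_mul_of_nonneg_left h3' hγ
  obtain rfl : α = 1 - β - γ := by linarith
  linarith

theorem Plane.eq_of_planeForm {p q : Plane} (h : ∀ m, planeForm m p = planeForm m q) :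
    p = q := by
  have h3 : Real.sqrt 3 ≠ 0 := by positivity
  have h0 := h 0
  have h2 := h 2
  simp [planeForm, hexCoeff] at h0 h2
  rw [h2] at h0
  ext i
  fin_cases i
  · simpa using h0
  · exact h2

/-- Every point of the plane lies in some face. -/
theorem exists_mem_hull (p : Plane) : ∃ a b c, Clique3 a b c ∧ p ∈ hull a b c := by
  set x := planeForm 0 p with hx
  set y := planeForm 2 p with hy
  have hform : ∀ m, planeForm m p = (hexCoeff m).1 * x + (hexCoeff m).2 * y := by
    intro m; simp [hx, hy, planeForm, hexCoeff]
  have hx0 := Int.floor_le x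
  have hx1 := Int.lt_floor_add_one x
  have hy0 := Int.floor_le y
  have hy1 := Int.lt_floor_add_one y
  -- The lattice parallelogram containing `p` is cut into two faces by its short diagonal. The
  -- weights are the barycentric coordinates in the face concerned.
  by_cases hle : (x - ⌊x⌋) + (y - ⌊y⌋) ≤ 1
  · refine ⟨(⌊x⌋, ⌊y⌋), (⌊x⌋, ⌊y⌋) + dir 0, (⌊x⌋, ⌊y⌋) + dir (0 + 1),
      ⟨(gridAdj_add_dir _ _).near, (gridAdj_dir_dir (Or.inl rfl) _).near,
        (gridAdj_add_dir _ _).near⟩, mem_hull.2 ⟨1 - (x - ⌊x⌋) - (y - ⌊y⌋), x - ⌊x⌋, y - ⌊y⌋,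
        by linarith, by linarith, by linarith, by ring, ?_⟩⟩
    refine Plane.eq_of_planeForm fun m => ?_
    rw [planeForm_combination, hform]
    simp [hexForm, dir, -Int.self_sub_floor]
    ring
  · refine ⟨(⌊x⌋ + 1, ⌊y⌋ + 1), (⌊x⌋ + 1, ⌊y⌋ + 1) + dir 3, (⌊x⌋ + 1, ⌊y⌋ + 1) + dir (3 + 1),
      ⟨(gridAdj_add_dir _ _).near, (gridAdj_dir_dir (Or.inl rfl) _).near,
        (gridAdj_add_dir _ _).near⟩, mem_hull.2 ⟨(x - ⌊x⌋) + (y - ⌊y⌋) - 1, 1 - (x - ⌊x⌋),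
        1 - (y - ⌊y⌋), by linarith, by linarith, by linarith, by ring, ?_⟩⟩
    refine Plane.eq_of_planeForm fun m => ?_
    rw [planeForm_combination, hform]
    simp [hexForm, dir, -Int.self_sub_floor]
    ring

/-! ### Shapes and connectedness -/

/-- The vertices of `X` with all edges and faces that they span. -/
def spannedShape (X : Set Vertex) : Set Plane :=
  ⋃₀ {C | ∃ a ∈ X, ∃ b ∈ X, ∃ c ∈ X, Clique3 a b c ∧ C = hull a b c}

/-- A point of a face lies in the star of a vertex of this face exactly if that vertex has positive
weight, and it lies in no other stars. So it avoids all stars around `Xᶜ` if and only if it is a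
combination of vertices of `X`. -/
theorem compl_spannedShape (X : Set Vertex) : (spannedShape X)ᶜ = ⋃ v ∈ Xᶜ, openStar v := by
  classical
  ext p
  simp only [Set.mem_compl_iff, Set.mem_iUnion, exists_prop]
  constructor
  · intro hp
    by_contra! hno
    obtain ⟨a, b, c, hcl, hpc⟩ := exists_mem_hull p
    obtain ⟨α, β, γ, hα, hβ, hγ, hsum, hcomb⟩ := mem_hull.1 hpc
    have hX : ∀ v, p ∈ openStar v → v ∈ X := fun v hv => by
      by_contra h; exact hno v h hv
    have ha : 0 < α → a ∈ X := fun h => hX a <| by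
      rw [hcomb]; exact mem_openStar_of_pos hcl.1.symm hcl.2.2.symm h hβ hγ hsum
    have hb : 0 < β → b ∈ X := fun h => hX b <| by
      rw [hcomb, add_comm (α • point a)]
      exact mem_openStar_of_pos hcl.1 hcl.2.1.symm h hα hγ (by linarith)
    have hc : 0 < γ → c ∈ X := fun h => hX c <| by
      rw [hcomb, add_comm, ← add_assoc]
      exact mem_openStar_of_pos hcl.2.2 hcl.2.1 h hα hβ (by linarith)
    obtain ⟨w, hwX, hw⟩ : ∃ w ∈ X, w = a ∨ w = b ∨ w = c := by
      rcases hα.lt_or_eq with h | h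
      · exact ⟨a, ha h, Or.inl rfl⟩
      rcases hβ.lt_or_eq with h' | h'
      · exact ⟨b, hb h', Or.inr (Or.inl rfl)⟩
      · exact ⟨c, hc (by linarith), Or.inr (Or.inr rfl)⟩
    have hnear : ∀ u v, (u = a ∨ u = b ∨ u = c) → (v = a ∨ v = b ∨ v = c) → Near u v := by
      obtain ⟨h1, h2, h3⟩ := hcl
      rintro u v (rfl | rfl | rfl) (rfl | rfl | rfl) <;>
        first | exact .refl _ | assumption | (apply Near.symm; assumption)
    -- Vertices of the face outside `X` have weight zero; replacing them by a vertex `w` of the same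
    -- face in `X` changes neither the combination nor the clique property.
    let r : Vertex → Vertex := fun v => if v ∈ X then v else w
    have hr : ∀ v, r v ∈ X := fun v => by simp only [r]; split_ifs <;> assumption
    have hr' : ∀ v, (v = a ∨ v = b ∨ v = c) → (r v = a ∨ r v = b ∨ r v = c) := fun v hv => by
      simp only [r]; split_ifs <;> assumption
    have hcoef : ∀ (t : ℝ) (v : Vertex), 0 ≤ t → (0 < t → v ∈ X) →
        t • point v = t • point (r v) := by
      intro t v ht hv
      rcases ht.lt_or_eq with h | h
      · simp only [r, if_pos (hv h)]
      · rw [← h, zero_smul, zero_smul]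
    have ha' := hr' a (Or.inl rfl)
    have hb' := hr' b (Or.inr (Or.inl rfl))
    have hc' := hr' c (Or.inr (Or.inr rfl))
    refine hp ⟨_, ⟨r a, hr a, r b, hr b, r c, hr c,
      ⟨hnear _ _ ha' hb', hnear _ _ hb' hc', hnear _ _ ha' hc'⟩, rfl⟩,
      mem_hull.2 ⟨α, β, γ, hα, hβ, hγ, hsum, ?_⟩⟩
    rw [hcomb, hcoef α a hα ha, hcoef β b hβ hb, hcoef γ c hγ hc]
  · rintro ⟨v, hv, hpv⟩ ⟨_, ⟨a, ha, b, hb, c, hc, hcl, rfl⟩, hp⟩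
    rcases eq_of_mem_openStar_of_mem_hull hcl hp hpv with rfl | rfl | rfl
    exacts [hv ha, hv hb, hv hc]

theorem hull_subset_spannedShape {X : Set Vertex} {a b c : Vertex} (ha : a ∈ X) (hb : b ∈ X)
    (hc : c ∈ X) (h : Clique3 a b c) : hull a b c ⊆ spannedShape X :=
  Set.subset_sUnion_of_mem ⟨a, ha, b, hb, c, hc, h, rfl⟩

theorem clique3_pair {a b : Vertex} (h : Near a b) : Clique3 a b b := ⟨h, .refl b, h⟩

theorem formsShape_spannedShape (X : Set Vertex) : FormsShape X (spannedShape X) where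
  vertices v := by
    constructor
    · intro hv
      refine hull_subset_spannedShape hv hv hv (clique3_pair (.refl v)) ?_
      rw [hull_singleton]; rfl
    · intro hv
      by_contra h
      have : point v ∈ (spannedShape X)ᶜ := by
        rw [compl_spannedShape]
        exact Set.mem_biUnion h (point_mem_openStar v)
      exact this hv
  edges u hu v hv h := by
    rw [← hull_pair]
    exact hull_subset_spannedShape hu hv hv (clique3_pair h.near)

theorem Convex.joinedIn {s t : Set Plane} (hs : Convex ℝ s) (hst : s ⊆ t) {p q : Plane}
    (hp : p ∈ s) (hq : q ∈ s) : JoinedIn t p q :=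
  ((hs.isPathConnected ⟨p, hp⟩).joinedIn p hp q hq).mono hst

theorem Linked.joinedIn {X : Set Vertex} {S : Set Plane} (hX : ∀ v ∈ X, point v ∈ S)
    (hS : ∀ u ∈ X, ∀ v ∈ X, GridAdj u v → JoinedIn S (point u) (point v)) {u v : Vertex}
    (hu : u ∈ X) (h : Linked X u v) : JoinedIn S (point u) (point v) := by
  induction h with
  | refl => exact .refl (hX u hu)
  | tail _ h ih => exact ih.trans (hS _ h.2.1 _ h.2.2 h.1)

theorem isConnected_of_joinedIn {X : Set Vertex} {S : Set Plane} (hne : X.Nonempty)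
    (hconn : GridConnected X) (hX : ∀ v ∈ X, point v ∈ S)
    (hS : ∀ u ∈ X, ∀ v ∈ X, GridAdj u v → JoinedIn S (point u) (point v))
    (hp : ∀ p ∈ S, ∃ v ∈ X, JoinedIn S (point v) p) : IsConnected S := by
  obtain ⟨u, hu⟩ := hne
  refine IsPathConnected.isConnected ⟨point u, hX u hu, fun {p} h => ?_⟩
  obtain ⟨v, hv, hvp⟩ := hp p h
  exact ((hconn u hu v hv).joinedIn hX hS hu).trans hvp

theorem isSimplyConnectedShape_spannedShape {X : Set Vertex} (hfin : X.Finite)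
    (hne : X.Nonempty) (hX : GridConnected X) (hXc : GridConnected Xᶜ) :
    IsSimplyConnectedShape (spannedShape X) where
  cells := by
    refine ⟨_, ?_, ?_, rfl⟩
    · refine ((hfin.prod (hfin.prod hfin)).image
        fun x : Vertex × Vertex × Vertex => hull x.1 x.2.1 x.2.2).subset ?_
      rintro _ ⟨a, ha, b, hb, c, hc, _, rfl⟩
      exact ⟨(a, b, c), ⟨ha, hb, hc⟩, rfl⟩
    · rintro _ ⟨a, _, b, _, c, _, h, rfl⟩
      exact h.isCell
  connected := by
    have hforms := formsShape_spannedShape X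
    refine isConnected_of_joinedIn hne hX (fun v => (hforms.vertices v).1) ?_ ?_
    · intro u hu v hv h
      exact (convex_segment _ _).joinedIn (hforms.edges u hu v hv h) (left_mem_segment _ _ _)
        (right_mem_segment _ _ _)
    · rintro p ⟨_, ⟨a, ha, b, hb, c, hc, h, rfl⟩, hp⟩
      exact ⟨a, ha, (convex_convexHull ℝ _).joinedIn (hull_subset_spannedShape ha hb hc h)
        (subset_convexHull ℝ _ (by simp)) hp⟩
  compl_connected := by
    rw [compl_spannedShape]
    have hsub : ∀ v ∈ Xᶜ, openStar v ⊆ ⋃ v ∈ Xᶜ, openStar v := fun v hv =>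
      Set.subset_biUnion_of_mem (u := openStar) hv
    refine isConnected_of_joinedIn hfin.infinite_compl.nonempty hXc
      (fun v hv => hsub v hv (point_mem_openStar v)) ?_ ?_
    · intro u hu v hv h
      -- The stars of adjacent vertices share the midpoint of the edge. The vanishing third term
      -- only serves to match `mem_openStar_of_pos`.
      have h1 : (1 / 2 : ℝ) • point u + (1 / 2 : ℝ) • point v + (0 : ℝ) • point v ∈ openStar u :=
        mem_openStar_of_pos h.symm.near h.symm.near (by norm_num) (by norm_num) le_rfl
          (by norm_num)
      have h2 : (1 / 2 : ℝ) • point v + (1 / 2 : ℝ) • point u + (0 : ℝ) • point u ∈ openStar v :=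
        mem_openStar_of_pos h.near h.near (by norm_num) (by norm_num) le_rfl (by norm_num)
      rw [zero_smul, add_zero] at h1 h2
      rw [add_comm] at h2
      exact ((convex_openStar u).joinedIn (hsub u hu) (point_mem_openStar u) h1).trans
        ((convex_openStar v).joinedIn (hsub v hv) h2 (point_mem_openStar v))
    · intro p hp
      obtain ⟨v, hv, hpv⟩ := Set.mem_iUnion₂.1 hp
      exact ⟨v, hv, (convex_openStar v).joinedIn (hsub v hv) (point_mem_openStar v) hpv⟩

/-- Stars of distinct nonadjacent vertices are disjoint, so the stars around one component of `Y`
and those around the rest would separate `S`. Neither family can cover `S` alone, as a star contains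
no vertex but its center. -/
theorem gridConnected_of_isPreconnected {Y : Set Vertex} {S : Set Plane} (hS : IsPreconnected S)
    (hcover : S ⊆ ⋃ v ∈ Y, openStar v) (hY : ∀ v ∈ Y, point v ∈ S) : GridConnected Y := by
  intro u hu v hv
  by_contra hno
  let A : Set Vertex := {w ∈ Y | Linked Y u w}
  let B : Set Vertex := {w ∈ Y | ¬ Linked Y u w}
  have hopen : ∀ Z : Set Vertex, IsOpen (⋃ v ∈ Z, openStar v) := fun Z =>
    isOpen_biUnion fun v _ => isOpen_openStar v
  have hdisj : Disjoint (⋃ v ∈ A, openStar v) (⋃ v ∈ B, openStar v) := by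
    rw [Set.disjoint_left]
    intro p hp hp'
    obtain ⟨a, ha, hpa⟩ := Set.mem_iUnion₂.1 hp
    obtain ⟨b, hb, hpb⟩ := Set.mem_iUnion₂.1 hp'
    refine hb.2 ?_
    rcases near_iff.1 (near_of_openStar hpb hpa) with rfl | h
    · exact ha.2
    · exact ha.2.tail ⟨h, ha.1, hb.1⟩
  have hsub : S ⊆ (⋃ v ∈ A, openStar v) ∪ ⋃ v ∈ B, openStar v := by
    intro p hp
    obtain ⟨w, hw, hpw⟩ := Set.mem_iUnion₂.1 (hcover hp)
    by_cases h : Linked Y u w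
    · exact Or.inl (Set.mem_biUnion (show w ∈ A from ⟨hw, h⟩) hpw)
    · exact Or.inr (Set.mem_biUnion (show w ∈ B from ⟨hw, h⟩) hpw)
  have hmem : ∀ (Z : Set Vertex) w, w ∈ Y → S ⊆ (⋃ v ∈ Z, openStar v) → w ∈ Z := by
    intro Z w hw h
    obtain ⟨z, hz, hz'⟩ := Set.mem_iUnion₂.1 (h (hY w hw))
    rwa [eq_of_point_mem_openStar hz']
  rcases hS.subset_or_subset (hopen A) (hopen B) hdisj hsub with h | h
  · exact hno (hmem A v hv h).2
  · exact (hmem B u hu h).2 .refl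

theorem gridConnected_of_formsShape {X : Set Vertex} {S : Set Plane} (hS : IsShape S)
    (h : FormsShape X S) : GridConnected X := by
  refine gridConnected_of_isPreconnected hS.connected.isPreconnected ?_
    fun v => (h.vertices v).1
  obtain ⟨F, -, hF, rfl⟩ := hS.cells
  rintro p ⟨C, hC, hp⟩
  obtain ⟨a, b, c, hcl, rfl⟩ := (hF C hC).exists_eq_hull
  have hX : ∀ v, point v ∈ hull a b c → v ∈ X := fun v hv => (h.vertices v).2 ⟨_, hC, hv⟩
  obtain ⟨α, β, γ, hα, hβ, hγ, hsum, rfl⟩ := mem_hull.1 hp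
  rcases hα.lt_or_eq with h1 | h1
  · exact Set.mem_biUnion (hX a (subset_convexHull ℝ _ (by simp)))
      (mem_openStar_of_pos hcl.1.symm hcl.2.2.symm h1 hβ hγ hsum)
  rcases hβ.lt_or_eq with h2 | h2
  · refine Set.mem_biUnion (hX b (subset_convexHull ℝ _ (by simp))) ?_
    rw [add_comm (α • point a)]
    exact mem_openStar_of_pos hcl.1 hcl.2.1.symm h2 hα hγ (by linarith)
  · refine Set.mem_biUnion (hX c (subset_convexHull ℝ _ (by simp))) ?_
    rw [add_comm, ← add_assoc]
    exact mem_openStar_of_pos hcl.2.2 hcl.2.1 (by linarith) hα hβ (by linarith)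

theorem nonempty_of_formsShape {X : Set Vertex} {S : Set Plane} (hS : IsShape S)
    (h : FormsShape X S) : X.Nonempty := by
  obtain ⟨p, hp⟩ := hS.connected.nonempty
  obtain ⟨F, -, hF, rfl⟩ := hS.cells
  obtain ⟨C, hC, hp⟩ := hp
  obtain ⟨a, b, c, -, rfl⟩ := (hF C hC).exists_eq_hull
  exact ⟨a, (h.vertices a).2 ⟨_, hC, subset_convexHull ℝ _ (by simp)⟩⟩

/-- A simply connected shape contains every face whose three vertices it contains. -/
theorem spannedShape_subset {X : Set Vertex} {S : Set Plane} (hfin : X.Finite)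
    (hS : IsSimplyConnectedShape S) (h : FormsShape X S) : spannedShape X ⊆ S := by
  have hedge : ∀ u ∈ X, ∀ v ∈ X, Near u v → segment ℝ (point u) (point v) ⊆ S := by
    intro u hu v hv huv
    rcases near_iff.1 huv.symm with rfl | hadj
    · rw [segment_same]; exact Set.singleton_subset_iff.2 ((h.vertices v).1 hv)
    · exact h.edges u hu v hv hadj
  rintro p ⟨_, ⟨a, ha, b, hb, c, hc, hcl, rfl⟩, hp⟩
  by_contra hpS
  have hab : a ≠ b := by
    rintro rfl
    refine hpS (hedge a ha c hc hcl.2.2 ?_)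
    rwa [hull, Set.insert_eq_of_mem (by simp), convexHull_pair] at hp
  have hbc : b ≠ c := by
    rintro rfl
    exact hpS (hedge a ha b hb hcl.1 (hull_pair a b ▸ hp))
  have hac : a ≠ c := by
    rintro rfl
    refine hpS (hedge a ha b hb hcl.1 ?_)
    rwa [hull, Set.pair_comm, Set.insert_eq_of_mem (by simp), convexHull_pair] at hp
  -- the interior of the face
  let O := openStar a ∩ openStar b ∩ openStar c
  have hOopen : IsOpen O := ((isOpen_openStar a).inter (isOpen_openStar b)).inter
    (isOpen_openStar c)
  have hclosed : IsClosed (hull a b c) :=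
    ((Set.toFinite {point a, point b, point c}).isCompact_convexHull ℝ).isClosed
  have hboundary : ∀ q ∈ hull a b c, q ∈ O ∨ q ∈ S := by
    intro q hq
    obtain ⟨α, β, γ, hα, hβ, hγ, hsum, rfl⟩ := mem_hull.1 hq
    rcases hα.lt_or_eq with h1 | rfl
    · rcases hβ.lt_or_eq with h2 | rfl
      · rcases hγ.lt_or_eq with h3 | rfl
        · refine Or.inl ⟨⟨mem_openStar_of_pos hcl.1.symm hcl.2.2.symm h1 hβ hγ hsum, ?_⟩, ?_⟩
          · rw [add_comm (α • point a)]
            exact mem_openStar_of_pos hcl.1 hcl.2.1.symm h2 hα hγ (by linarith)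
          · rw [add_comm, ← add_assoc]
            exact mem_openStar_of_pos hcl.2.2 hcl.2.1 h3 hα hβ (by linarith)
        · exact Or.inr (hedge a ha b hb hcl.1 ⟨α, β, hα, hβ, by linarith, by simp⟩)
      · exact Or.inr (hedge a ha c hc hcl.2.2 ⟨α, γ, hα, hγ, by linarith, by simp⟩)
    · exact Or.inr (hedge b hb c hc hcl.2.1 ⟨β, γ, hβ, hγ, by linarith, by simp⟩)
  -- A cell that meets the interior of the face has `a`, `b` and `c` among its vertices; it would
  -- contain the whole face, including the missing point `p`.
  have hOS : O ⊆ Sᶜ := by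
    intro q hqO hqS
    obtain ⟨F, -, hF, rfl⟩ := hS.cells
    obtain ⟨C, hC, hqC⟩ := hqS
    obtain ⟨a', b', c', hcl', rfl⟩ := (hF C hC).exists_eq_hull
    refine hpS ⟨_, hC, convexHull_mono ?_ hp⟩
    have hmem : ∀ v, q ∈ openStar v → point v ∈ ({point a', point b', point c'} : Set Plane) := by
      intro v hv
      rcases eq_of_mem_openStar_of_mem_hull hcl' hqC hv with rfl | rfl | rfl <;> simp
    rintro _ (rfl | rfl | rfl)
    exacts [hmem a hqO.1.1, hmem b hqO.1.2, hmem c hqO.2]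
  have hOhull : O ⊆ hull a b c := by
    intro q hq
    obtain ⟨a', b', c', hcl', hq'⟩ := exists_mem_hull q
    have e1 := eq_of_mem_openStar_of_mem_hull hcl' hq' hq.1.1
    have e2 := eq_of_mem_openStar_of_mem_hull hcl' hq' hq.1.2
    have e3 := eq_of_mem_openStar_of_mem_hull hcl' hq' hq.2
    refine convexHull_mono ?_ hq'
    have : ∀ v, (v = a' ∨ v = b' ∨ v = c') → v = a ∨ v = b ∨ v = c := by
      rcases e1 with rfl | rfl | rfl <;> rcases e2 with rfl | rfl | rfl <;>
        rcases e3 with rfl | rfl | rfl <;>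
        first | exact absurd rfl hab | exact absurd rfl hbc | exact absurd rfl hac | tauto
    have hmem : ∀ v, (v = a' ∨ v = b' ∨ v = c') →
        point v ∈ ({point a, point b, point c} : Set Plane) := by
      intro v hv
      rcases this v hv with rfl | rfl | rfl <;> simp
    rintro _ (rfl | rfl | rfl)
    exacts [hmem a' (by simp), hmem b' (by simp), hmem c' (by simp)]
  -- The boundary of the face lies in `S`, so it separates `p`, which is in the face, from the
  -- remote vertex `w` within the complement of `S`.
  have hcover : Sᶜ ⊆ O ∪ (hull a b c)ᶜ := fun q hq => by
    by_cases hqh : q ∈ hull a b c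
    · exact Or.inl ((hboundary q hqh).resolve_right hq)
    · exact Or.inr hqh
  have hdisj : Disjoint O (hull a b c)ᶜ := Set.disjoint_compl_right_iff_subset.2 hOhull
  obtain ⟨w, hw⟩ := hfin.infinite_compl.nonempty
  have hwS : point w ∈ Sᶜ := fun h' => hw ((h.vertices w).2 h')
  rcases hS.compl_connected.isPreconnected.subset_or_subset hOopen hclosed.isOpen_compl hdisj
    hcover with h' | h'
  · exact hw (eq_of_point_mem_openStar (h' hwS).1.1 ▸ ha)
  · exact h' hpS hp

theorem gridConnected_compl_of_formsShape {X : Set Vertex} {S : Set Plane} (hfin : X.Finite)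
    (hS : IsSimplyConnectedShape S) (h : FormsShape X S) : GridConnected Xᶜ := by
  refine gridConnected_of_isPreconnected hS.compl_connected.isPreconnected ?_
    fun v hv hv' => hv ((h.vertices v).2 hv')
  rw [← compl_spannedShape]
  exact Set.compl_subset_compl.2 (spannedShape_subset hfin hS h)

/-! ### Executions of the lattice consumption phase -/

theorem PortLabeling.dirOf_injective (l : PortLabeling) : Function.Injective l.dirOf := by
  intro i j h
  unfold PortLabeling.dirOf at h
  split_ifs at h
  · exact sub_right_injective h
  · exact add_right_injective _ h

theorem PortLabeling.dirOf_surjective (l : PortLabeling) : Function.Surjective l.dirOf :=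
  Finite.surjective_of_injective l.dirOf_injective

namespace Config

variable {P : Type}

/-- The internal state of `p`. -/
def phase (c : Config latticeConsumption P) (p : P) : PhaseState := c.state p

/-- The message that `p` receives if it is activated. -/
noncomputable def mail (c : Config latticeConsumption P) (l : P → PortLabeling) (p : P) :
    Fin 6 → Option Report := c.inbox l p

/-- What `p` memorizes if it is activated. -/
noncomputable def seen (c : Config latticeConsumption P) (l : P → PortLabeling) (p : P) :
    Fin 6 → Option Report :=
  updateMemory (c.phase p).memory (c.mail l p)

/-- The ports of `p` that lead to neighbors. -/
noncomputable def ports (c : Config latticeConsumption P) (l : P → PortLabeling) (p : P) :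
    Finset (Fin 6) :=
  neighborPorts (c.view l p)

/-- What `p` announced when it was last active. -/
noncomputable def report (c : Config latticeConsumption P) (l : P → PortLabeling) (p : P) :
    Report :=
  ⟨(c.phase p).eligible, (c.phase p).candidate,
    ownStatus (c.phase p).eligible (c.ports l p) (c.phase p).memory⟩

/-- The vertices of Eligible particles. -/
def eligibleSet (c : Config latticeConsumption P) : Set Vertex :=
  {v | ∃ p, c.head p = v ∧ (c.phase p).eligible = true}

/-- If it is activated, `p` takes a decision. -/
def Decides (c : Config latticeConsumption P) (l : P → PortLabeling) (p : P) : Prop :=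
  (∀ i ∈ c.ports l p, announced (c.seen l p) i ≠ .unknown) ∧ (c.phase p).eligible = true ∧
    (c.phase p).candidate = false ∧ (c.phase p).memory = c.seen l p

/-- The decision that `p` takes. -/
noncomputable def choice (c : Config latticeConsumption P) (l : P → PortLabeling) (p : P) :
    Decision :=
  decision (eligiblePorts (c.ports l p) (c.seen l p)) (c.seen l p)

/-- In this form Stability transfers everything known about the messages just read to the memory on
which the last announcement was based. -/
theorem stable_iff {q : PhaseState} {inbox : Fin 6 → Option Report} :
    (∀ i m, inbox i = some m → q.memory i = some m) ↔ q.memory = updateMemory q.memory inbox := by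
  constructor
  · intro h
    funext i
    unfold updateMemory
    cases hi : inbox i with
    | none => rfl
    | some m => exact h i m hi
  · intro h i m hi
    rw [h, updateMemory, hi]

open Classical in
theorem transition_eq (q : PhaseState) (view : Fin 6 → Content)
    (inbox : Fin 6 → Option Report) :
    let M := updateMemory q.memory inbox
    let d := if (∀ i ∈ neighborPorts view, announced M i ≠ .unknown) ∧ q.eligible = true ∧
        q.candidate = false ∧ q.memory = M
      then decision (eligiblePorts (neighborPorts view) M) M else .wait
    (phaseTransition q view inbox).state.eligible =
        (match d with | .eliminate => false | _ => q.eligible) ∧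
      (phaseTransition q view inbox).state.candidate =
        (match d with | .becomeCandidate => true | _ => q.candidate) := by
  constructor <;> simp only [phaseTransition, decide_eq_true_eq, stable_iff]

end Config

open Config

variable {P : Type} {l : P → PortLabeling} {act : ℕ → Set P}
  {c : ℕ → Config latticeConsumption P}

namespace IsExecution

theorem head_tail (hx : IsExecution l act c) (t : ℕ) :
    (c t).head = (c 0).head ∧ (c t).tail = (c 0).tail := by
  induction t with
  | zero => exact ⟨rfl, rfl⟩
  | succ t ih =>
    have key : ∀ p, (c (t + 1)).head p = (c t).head p ∧ (c (t + 1)).tail p = (c t).tail p := by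
      intro p
      by_cases hp : p ∈ act t
      · exact (hx.step t).stay p hp rfl
      · exact ⟨((hx.step t).inactive p hp).1, ((hx.step t).inactive p hp).2.1⟩
    exact ⟨(funext fun p => (key p).1).trans ih.1, (funext fun p => (key p).2).trans ih.2⟩

theorem head_eq (hx : IsExecution l act c) (t : ℕ) (p : P) : (c t).head p = (c 0).head p := by
  rw [(hx.head_tail t).1]

theorem tail_eq (hx : IsExecution l act c) (t : ℕ) (p : P) : (c t).tail p = none := by
  rw [(hx.head_tail t).2, hx.initial.contracted p]

theorem target_eq (hx : IsExecution l act c) (t : ℕ) (p : P) (i : Fin 6) :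
    (c t).target l p i = (c 0).target l p i := by
  rw [target, target, hx.head_eq t]

theorem view_eq (hx : IsExecution l act c) (t : ℕ) (p : P) :
    (c t).view l p = (c 0).view l p := by
  funext i
  obtain ⟨h1, h2⟩ := hx.head_tail t
  unfold view target
  rw [h1, h2]

theorem ports_eq (hx : IsExecution l act c) (t : ℕ) (p : P) :
    (c t).ports l p = (c 0).ports l p := by
  rw [ports, ports, hx.view_eq]

theorem view_eq_otherHead (hx : IsExecution l act c) {p : P} {i : Fin 6} :
    (c 0).view l p i = .otherHead ↔ ∃ q, (c 0).head q = (c 0).target l p i := by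
  simp only [view, hx.tail_eq 0]
  by_cases h : ∃ q, (c 0).head q = (c 0).target l p i
  · simp [h]
  · simp only [h, if_false, iff_false, reduceCtorEq]
    split_ifs <;> simp

theorem mem_ports (hx : IsExecution l act c) {p : P} {i : Fin 6} :
    i ∈ (c 0).ports l p ↔ ∃ q, (c 0).head q = (c 0).target l p i := by
  rw [ports, neighborPorts, Finset.mem_filter, hx.view_eq_otherHead]
  simp

theorem phase_of_notMem (hx : IsExecution l act c) {t : ℕ} {p : P} (hp : p ∉ act t) :
    (c (t + 1)).phase p = (c t).phase p := ((hx.step t).inactive p hp).2.2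

theorem phase_of_mem (hx : IsExecution l act c) {t : ℕ} {p : P} (hp : p ∈ act t) :
    (c (t + 1)).phase p =
      (phaseTransition ((c t).phase p) ((c t).view l p) ((c t).mail l p)).state :=
  (hx.step t).state p hp

theorem memory_of_mem (hx : IsExecution l act c) {t : ℕ} {p : P} (hp : p ∈ act t) :
    ((c (t + 1)).phase p).memory = (c t).seen l p := by
  rw [hx.phase_of_mem hp]; rfl

open Classical in
theorem flags_of_mem (hx : IsExecution l act c) {t : ℕ} {p : P} (hp : p ∈ act t) :
    ((c (t + 1)).phase p).eligible =
        (match (if (c t).Decides l p then (c t).choice l p else .wait) with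
          | .eliminate => false | _ => ((c t).phase p).eligible) ∧
      ((c (t + 1)).phase p).candidate =
        (match (if (c t).Decides l p then (c t).choice l p else .wait) with
          | .becomeCandidate => true | _ => ((c t).phase p).candidate) := by
  rw [hx.phase_of_mem hp]
  have h := transition_eq ((c t).phase p) ((c t).view l p) ((c t).mail l p)
  -- The conditionals to be matched may differ in their decidability instances.
  have e : ∀ (Q : Prop) (i₁ i₂ : Decidable Q) (d₁ d₂ : Decision),
      @ite _ Q i₁ d₁ d₂ = @ite _ Q i₂ d₁ d₂ := fun Q i₁ i₂ _ _ => by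
    rw [Subsingleton.elim i₁ i₂]
  unfold Decides Config.choice ports seen
  rw [e _ (Classical.propDecidable _) _]
  exact h

theorem not_eligible_succ (hx : IsExecution l act c) {t : ℕ} {p : P}
    (h : ((c t).phase p).eligible = true) (h' : ((c (t + 1)).phase p).eligible = false) :
    p ∈ act t ∧ (c t).Decides l p ∧ (c t).choice l p = .eliminate := by
  classical
  by_cases hp : p ∈ act t
  · have := (hx.flags_of_mem hp).1
    by_cases hd : (c t).Decides l p
    · rw [if_pos hd] at this
      cases hc : (c t).choice l p <;> simp_all
    · rw [if_neg hd] at this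
      simp_all
  · rw [hx.phase_of_notMem hp, h] at h'
    cases h'

theorem candidate_succ (hx : IsExecution l act c) {t : ℕ} {p : P}
    (h : ((c t).phase p).candidate = false) (h' : ((c (t + 1)).phase p).candidate = true) :
    p ∈ act t ∧ (c t).Decides l p ∧ (c t).choice l p = .becomeCandidate := by
  classical
  by_cases hp : p ∈ act t
  · have := (hx.flags_of_mem hp).2
    by_cases hd : (c t).Decides l p
    · rw [if_pos hd] at this
      cases hc : (c t).choice l p <;> simp_all
    · rw [if_neg hd] at this
      simp_all
  · rw [hx.phase_of_notMem hp, h] at h'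
    cases h'

theorem eliminated_of_choice (hx : IsExecution l act c) {t : ℕ} {p : P} (hp : p ∈ act t)
    (hd : (c t).Decides l p) (h : (c t).choice l p = .eliminate) :
    ((c (t + 1)).phase p).eligible = false := by
  classical
  rw [(hx.flags_of_mem hp).1, if_pos hd, h]

theorem candidate_of_choice (hx : IsExecution l act c) {t : ℕ} {p : P} (hp : p ∈ act t)
    (hd : (c t).Decides l p) (h : (c t).choice l p = .becomeCandidate) :
    ((c (t + 1)).phase p).candidate = true := by
  classical
  rw [(hx.flags_of_mem hp).2, if_pos hd, h]

theorem eligible_of_succ (hx : IsExecution l act c) {t : ℕ} {p : P}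
    (h : ((c (t + 1)).phase p).eligible = true) : ((c t).phase p).eligible = true := by
  classical
  by_cases hp : p ∈ act t
  · rw [(hx.flags_of_mem hp).1] at h
    cases hc : (if (c t).Decides l p then (c t).choice l p else .wait) <;> simp_all
  · rwa [hx.phase_of_notMem hp] at h

theorem candidate_succ_of_candidate (hx : IsExecution l act c) {t : ℕ} {p : P}
    (h : ((c t).phase p).candidate = true) : ((c (t + 1)).phase p).candidate = true := by
  classical
  by_cases hp : p ∈ act t
  · rw [(hx.flags_of_mem hp).2]
    cases hc : (if (c t).Decides l p then (c t).choice l p else .wait) <;> simp_all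
  · rwa [hx.phase_of_notMem hp]

theorem eligible_antitone (hx : IsExecution l act c) {s t : ℕ} (hst : s ≤ t) {p : P}
    (h : ((c t).phase p).eligible = true) : ((c s).phase p).eligible = true := by
  induction t, hst using Nat.le_induction with
  | base => exact h
  | succ t _ ih => exact ih (hx.eligible_of_succ h)

theorem candidate_monotone (hx : IsExecution l act c) {s t : ℕ} (hst : s ≤ t) {p : P}
    (h : ((c s).phase p).candidate = true) : ((c t).phase p).candidate = true := by
  induction t, hst using Nat.le_induction with
  | base => exact h
  | succ t _ ih => exact hx.candidate_succ_of_candidate ih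

theorem phase_zero (hx : IsExecution l act c) (p : P) :
    (c 0).phase p = ⟨true, false, false, fun _ => none⟩ := hx.initial.state p

/-- Candidates take no further decisions, and the decision that creates a Candidate is not the one
that eliminates. -/
theorem eligible_of_candidate (hx : IsExecution l act c) {t : ℕ} {p : P}
    (h : ((c t).phase p).candidate = true) : ((c t).phase p).eligible = true := by
  induction t with
  | zero => rw [hx.phase_zero]
  | succ t ih =>
    by_contra hne
    rw [Bool.not_eq_true] at hne
    cases hc : ((c t).phase p).candidate with
    | true =>
      have := (hx.not_eligible_succ (ih hc) hne).2.1.2.2.1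
      rw [hc] at this; cases this
    | false =>
      obtain ⟨_, hd, h1⟩ := hx.candidate_succ hc h
      rw [(hx.not_eligible_succ hd.2.1 hne).2.2] at h1
      cases h1

/-! ### Messages -/

theorem phase_of_never_active (hx : IsExecution l act c) {t : ℕ} {p : P}
    (h : ∀ s < t, p ∉ act s) : (c t).phase p = ⟨true, false, false, fun _ => none⟩ := by
  induction t with
  | zero => exact hx.phase_zero p
  | succ t ih =>
    rw [hx.phase_of_notMem (h t (Nat.lt_succ_self t))]
    exact ih fun s hs => h s (hs.trans (Nat.lt_succ_self t))

open Classical in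
/-- The last announcement before stage `t` of the particle `q`. -/
noncomputable def register (l : P → PortLabeling) (act : ℕ → Set P)
    (c : ℕ → Config latticeConsumption P) (t : ℕ) (q : P) : Option Report :=
  if ∃ s < t, q ∈ act s then some ((c t).report l q) else none

/-- A state changes only by an activation, which also announces the result. This is why the last
announcement can be computed from the current state. -/
theorem register_succ_of_notMem (hx : IsExecution l act c) {t : ℕ} {q : P} (hq : q ∉ act t) :
    register l act c (t + 1) q = register l act c t q := by
  have h1 : (∃ s < t + 1, q ∈ act s) ↔ ∃ s < t, q ∈ act s := by
    constructor
    · rintro ⟨s, hs, h⟩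
      rcases (Nat.lt_succ_iff_lt_or_eq.1 hs) with h' | rfl
      · exact ⟨s, h', h⟩
      · exact absurd h hq
    · rintro ⟨s, hs, h⟩
      exact ⟨s, hs.trans (Nat.lt_succ_self t), h⟩
  have h2 : (c (t + 1)).report l q = (c t).report l q := by
    rw [report, report, hx.phase_of_notMem hq, hx.ports_eq (t + 1), hx.ports_eq t]
  rw [register, register, h2]
  by_cases h : ∃ s < t, q ∈ act s
  · rw [if_pos h, if_pos (h1.2 h)]
  · rw [if_neg h, if_neg fun h' => h (h1.1 h')]

theorem register_succ_of_mem {t : ℕ} {q : P} (hq : q ∈ act t) :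
    register l act c (t + 1) q = some ((c (t + 1)).report l q) :=
  if_pos ⟨t, Nat.lt_succ_self t, hq⟩

theorem sends_imp {t : ℕ} {u v : Vertex} {m : Report} (hx : IsExecution l act c)
    (h : (c t).Sends l (act t) u v m) : ∃ q ∈ act t, (c 0).head q = u := by
  obtain ⟨q, hq, hu, _⟩ := h
  exact ⟨q, hq, by rw [← hx.head_eq t, hu]⟩

theorem outbox_eq (hx : IsExecution l act c) {t : ℕ} {q : P} (hq : q ∈ act t) {j : Fin 6}
    (hj : j ∈ (c t).ports l q) :
    ((c t).action l q).outbox j = some ((c (t + 1)).report l q) := by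
  rw [report, hx.phase_of_mem hq, hx.ports_eq (t + 1), ← hx.ports_eq t]
  exact if_pos hj

/-- An active particle announces its state to all its neighbors. -/
theorem pending_of_mem (hx : IsExecution l act c) {t : ℕ} {p q : P} {i : Fin 6}
    (hpq : (c 0).head q = (c 0).target l p i) (hq : q ∈ act t) :
    (c (t + 1)).mail l p i = some ((c (t + 1)).report l q) := by
  obtain ⟨j, hj⟩ := (l q).dirOf_surjective ((l p).dirOf i + 3)
  have htarget : (c 0).target l q j = (c 0).head p := by
    rw [target, hj, hpq, target, add_dir_add_dir_three]
  have hview : (c 0).view l q j = .otherHead := hx.view_eq_otherHead.2 ⟨p, htarget.symm⟩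
  have hports : j ∈ (c t).ports l q := by
    rw [hx.ports_eq]; exact hx.mem_ports.2 ⟨p, htarget.symm⟩
  rw [mail, inbox, hx.target_eq, hx.head_eq, ← hpq]
  refine (hx.step t).delivered _ _ _ ⟨⟨q, hq, hx.head_eq t q, j, ?_, ?_, ?_⟩, ?_⟩
  · rw [hx.target_eq, htarget]
  · rw [hx.view_eq, hview]
  · exact hx.outbox_eq hq hports
  · intro r hr
    rwa [hx.head_eq (t + 1), ← hx.head_eq t]

theorem mail_of_not_sends (hx : IsExecution l act c) {t : ℕ} {p : P} {i : Fin 6}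
    (h : ∀ q ∈ act t, (c 0).head q ≠ (c 0).target l p i) :
    (p ∈ act t → (c (t + 1)).mail l p i = none) ∧
      (p ∉ act t → (c (t + 1)).mail l p i = (c t).mail l p i) := by
  have hno : ¬ ∃ m, (c t).Delivers (c (t + 1)) l (act t) ((c 0).target l p i) ((c 0).head p) m := by
    rintro ⟨m, hm, _⟩
    obtain ⟨q, hq, hq'⟩ := hx.sends_imp hm
    exact h q hq hq'
  rw [mail, mail, inbox, inbox, hx.target_eq (t + 1), hx.target_eq t, hx.head_eq (t + 1),
    hx.head_eq t]
  refine ⟨fun hp => (hx.step t).read _ _ hno ⟨p, hp, hx.head_eq t p⟩,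
    fun hp => (hx.step t).kept _ _ hno ?_⟩
  rintro ⟨q, hq, hq'⟩
  rw [hx.head_eq] at hq'
  exact hp (hx.initial.head_injective hq' ▸ hq)

/-- No message arrives from a vertex that is not occupied. -/
theorem mail_of_notMem_ports (hx : IsExecution l act c) {p : P} {i : Fin 6}
    (hi : i ∉ (c 0).ports l p) (t : ℕ) : (c t).mail l p i = none := by
  have h : ∀ q, (c 0).head q ≠ (c 0).target l p i := fun q hq => hi (hx.mem_ports.2 ⟨q, hq⟩)
  induction t with
  | zero => exact hx.initial.pending _ _
  | succ t ih =>
    have := hx.mail_of_not_sends (t := t) (p := p) (i := i) fun q _ => h q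
    by_cases hp : p ∈ act t
    · exact this.1 hp
    · rw [this.2 hp, ih]

/-- If it is activated, a particle memorizes the last announcements of its neighbors. -/
theorem seen_eq_register (hx : IsExecution l act c) {p q : P} {i : Fin 6}
    (hpq : (c 0).head q = (c 0).target l p i) (t : ℕ) :
    (c t).seen l p i = register l act c t q := by
  -- The last announcement of `q` is pending until `p` reads it and memorized from then on; `seen`
  -- covers both cases.
  induction t with
  | zero =>
    have h1 : (c 0).mail l p i = none := hx.initial.pending _ _
    rw [seen, updateMemory, h1, hx.phase_zero, register, if_neg]
    rintro ⟨s, hs, _⟩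
    exact absurd hs (Nat.not_lt_zero s)
  | succ t ih =>
    by_cases hq : q ∈ act t
    · rw [seen, updateMemory, hx.pending_of_mem hpq hq, register_succ_of_mem hq]
    · rw [hx.register_succ_of_notMem hq, ← ih]
      have := hx.mail_of_not_sends (t := t) (p := p) (i := i) fun r hr hr' =>
        hq (hx.initial.head_injective (hr'.trans hpq.symm) ▸ hr)
      by_cases hp : p ∈ act t
      · rw [seen, updateMemory, this.1 hp, hx.memory_of_mem hp]
      · rw [seen, updateMemory, this.2 hp, hx.phase_of_notMem hp]
        rfl

end IsExecution

/-! ### Port numbers and directions -/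

/-- Corner types are invariant under the rotations and reflections of the six directions, of which
the labelings are instances. -/
theorem PortLabeling.cornerType_eq (l : PortLabeling) {A B : Finset (Fin 6)}
    (h : ∀ i, i ∈ A ↔ l.dirOf i ∈ B) : cornerType A = cornerType B := by
  have hB : B = A.image l.dirOf := by
    ext j
    obtain ⟨i, rfl⟩ := l.dirOf_surjective j
    rw [Finset.mem_image, ← h]
    exact ⟨fun hi => ⟨i, hi, rfl⟩, fun ⟨k, hk, hki⟩ => l.dirOf_injective hki ▸ hk⟩
  rw [hB]
  obtain ⟨z, r⟩ := l
  have key : ∀ (z : Fin 6) (r : Bool) (A : Finset (Fin 6)),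
      cornerType A = cornerType (A.image fun i => if r then z - i else z + i) := by
    decide +kernel
  exact key z r A

theorem PortLabeling.eq_triple (l : PortLabeling) {A B : Finset (Fin 6)}
    (h : ∀ i, i ∈ A ↔ l.dirOf i ∈ B) {i : Fin 6} :
    A = {i - 1, i, i + 1} ↔ B = {l.dirOf i + 5, l.dirOf i, l.dirOf i + 1} := by
  have hdir : ∀ j, l.dirOf j ∈ ({l.dirOf i + 5, l.dirOf i, l.dirOf i + 1} : Finset (Fin 6)) ↔
      j ∈ ({i - 1, i, i + 1} : Finset (Fin 6)) := by
    intro j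
    obtain ⟨z, r⟩ := l
    have key : ∀ (z : Fin 6) (r : Bool) (i j : Fin 6),
        (if r then z - j else z + j) ∈ ({(if r then z - i else z + i) + 5,
          (if r then z - i else z + i), (if r then z - i else z + i) + 1} : Finset (Fin 6)) ↔
        j ∈ ({i - 1, i, i + 1} : Finset (Fin 6)) := by decide +kernel
    exact key z r i j
  constructor
  · rintro rfl
    ext k
    obtain ⟨j, rfl⟩ := l.dirOf_surjective k
    rw [hdir, h]
  · rintro rfl
    ext j
    rw [h, hdir]

/-! ### Decisions -/

theorem decision_eliminate {E : Finset (Fin 6)} {M : Fin 6 → Option Report}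
    (h : decision E M = .eliminate) :
    (cornerType E = .corner 1 ∧ ∃ i ∈ E, announced M i ≠ .corner 1) ∨
      (cornerType E = .corner 2 ∧ ∃ i ∈ E, announced M i ≠ .corner 2) ∨
      (cornerType E = .corner 3 ∧ ∀ i, E = {i - 1, i, i + 1} → announced M i ≠ .corner 3) := by
  unfold decision at h
  split_ifs at h with h0 h1 h1' h2 h2' h3 h3'
  · exact Or.inl ⟨h1, by simpa using h1'⟩
  · exact Or.inr (Or.inl ⟨h2, by simpa using h2'⟩)
  · exact Or.inr (Or.inr ⟨h3, fun i hi ha => h3' ⟨i, hi, ha⟩⟩)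

theorem decision_becomeCandidate {E : Finset (Fin 6)} {M : Fin 6 → Option Report}
    (h : decision E M = .becomeCandidate) : ∃ k : Fin 4, k ≠ 3 ∧ cornerType E = .corner k ∧
      ∀ i ∈ E, announced M i = .corner k := by
  unfold decision at h
  split_ifs at h with h0 h1 h1' h2 h2' h3 h3'
  · refine ⟨0, by decide, h0, fun i hi => ?_⟩
    have : E = ∅ := by clear * - h0; revert E; decide +kernel
    simp [this] at hi
  · exact ⟨1, by decide, h1, h1'⟩
  · exact ⟨2, by decide, h2, h2'⟩

theorem decision_wait {E : Finset (Fin 6)} {M : Fin 6 → Option Report}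
    (h : decision E M = .wait) : cornerType E ≠ .corner 0 ∧ cornerType E ≠ .corner 1 ∧
      cornerType E ≠ .corner 2 ∧ (cornerType E = .corner 3 → IsLocked E M) := by
  unfold decision at h
  split_ifs at h with h0 h1 h1' h2 h2' h3 h3'
  · exact ⟨h0, h1, h2, fun _ => h3'⟩
  · exact ⟨h0, h1, h2, fun h => absurd h h3⟩

theorem card_of_cornerType {A : Finset (Fin 6)} {k : Fin 4} (h : cornerType A = .corner k) :
    A.card = k.val := by
  revert A k; decide +kernel

namespace IsExecution

/-! ### What particles know about their neighbors -/

theorem mem_eligibleSet (hx : IsExecution l act c) {t : ℕ} {q : P} :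
    (c 0).head q ∈ (c t).eligibleSet ↔ ((c t).phase q).eligible = true := by
  constructor
  · rintro ⟨r, hr, h⟩
    rw [hx.head_eq] at hr
    rwa [← hx.initial.head_injective hr]
  · intro h
    exact ⟨q, hx.head_eq t q, h⟩

theorem exists_of_mem_eligibleSet (hx : IsExecution l act c) {t : ℕ} {v : Vertex}
    (h : v ∈ (c t).eligibleSet) : ∃ q, (c 0).head q = v ∧ ((c t).phase q).eligible = true := by
  obtain ⟨q, hq, h⟩ := h
  exact ⟨q, by rw [← hx.head_eq t, hq], h⟩

theorem dirOf_mem_nbrs {t : ℕ} {p : P} {i : Fin 6} :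
    (l p).dirOf i ∈ nbrs (c t).eligibleSet ((c 0).head p) ↔
      (c 0).target l p i ∈ (c t).eligibleSet := mem_nbrs

/-- By the messages `M`, the particle `p` knows which of its neighbors are Eligible. -/
def Knows (l : P → PortLabeling) (c : ℕ → Config latticeConsumption P) (t : ℕ) (p : P)
    (M : Fin 6 → Option Report) : Prop :=
  ∀ i ∈ (c 0).ports l p, ∃ m, M i = some m ∧
    (m.eligible = true ↔ (c 0).target l p i ∈ (c t).eligibleSet)

theorem Knows.mem_eligiblePorts (hx : IsExecution l act c) {t : ℕ} {p : P}
    {M : Fin 6 → Option Report} (h : Knows l c t p M) (i : Fin 6) :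
    i ∈ eligiblePorts ((c 0).ports l p) M ↔
      (l p).dirOf i ∈ nbrs (c t).eligibleSet ((c 0).head p) := by
  rw [dirOf_mem_nbrs, eligiblePorts, Finset.mem_filter]
  constructor
  · rintro ⟨hi, m, hm, he⟩
    obtain ⟨m', hm', h'⟩ := h i hi
    rw [hm, Option.some_inj] at hm'
    exact h'.1 (hm' ▸ he)
  · intro hi
    obtain ⟨q, hq, _⟩ := hx.exists_of_mem_eligibleSet hi
    have hp := hx.mem_ports.2 ⟨q, hq⟩
    obtain ⟨m, hm, h'⟩ := h i hp
    exact ⟨hp, m, hm, h'.2 hi⟩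

theorem Knows.cornerType_eq (hx : IsExecution l act c) {t : ℕ} {p : P}
    {M : Fin 6 → Option Report} (h : Knows l c t p M) :
    cornerType (eligiblePorts ((c 0).ports l p) M) =
      cornerType (nbrs (c t).eligibleSet ((c 0).head p)) :=
  (l p).cornerType_eq (h.mem_eligiblePorts hx)

theorem register_eq_some {t : ℕ} {q : P} {m : Report} (h : register l act c t q = some m) :
    m = (c t).report l q := by
  unfold register at h
  split_ifs at h
  exact (Option.some_inj.1 h).symm

theorem seen_eq_some (hx : IsExecution l act c) {t : ℕ} {p q : P} {i : Fin 6} {m : Report}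
    (hpq : (c 0).head q = (c 0).target l p i) (h : (c t).seen l p i = some m) :
    m = (c t).report l q :=
  register_eq_some ((hx.seen_eq_register hpq t).symm.trans h)

/-- A flag changes only together with an announcement, so the Eligible flags that a particle can
read are current. Corner statuses lack this property, because they also depend on flags of other
particles. -/
theorem knows_seen (hx : IsExecution l act c) {t : ℕ} {p : P}
    (h : ∀ i ∈ (c 0).ports l p, (c t).seen l p i ≠ none) : Knows l c t p ((c t).seen l p) := by
  intro i hi
  obtain ⟨m, hm⟩ := Option.ne_none_iff_exists'.1 (h i hi)
  obtain ⟨q, hq⟩ := hx.mem_ports.1 hi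
  refine ⟨m, hm, ?_⟩
  rw [hx.seen_eq_some hq hm, ← hq, hx.mem_eligibleSet]
  rfl

theorem register_of_memory (hx : IsExecution l act c) {t : ℕ} {p : P} {i : Fin 6}
    (h : ((c t).phase p).memory i ≠ none) :
    register l act c t p = some ((c t).report l p) := by
  refine if_pos ?_
  by_contra! hno
  rw [hx.phase_of_never_active hno] at h
  exact h rfl

theorem seen_ne_none {t : ℕ} {p : P} {i : Fin 6} (h : ((c t).phase p).memory i ≠ none) :
    (c t).seen l p i ≠ none := by
  unfold seen updateMemory
  cases (c t).mail l p i with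
  | none => exact h
  | some m => simp

theorem announced_ne_unknown {M : Fin 6 → Option Report} {i : Fin 6}
    (h : announced M i ≠ .unknown) : M i ≠ none := by
  intro h'
  rw [announced, h'] at h
  exact h rfl

theorem Decides.knows (hx : IsExecution l act c) {t : ℕ} {p : P} (h : (c t).Decides l p) :
    Knows l c t p ((c t).seen l p) := by
  refine hx.knows_seen fun i hi => announced_ne_unknown (h.1 i ?_)
  rwa [hx.ports_eq]

theorem Knows.status (hx : IsExecution l act c) {t : ℕ} {p : P}
    (h : Knows l c t p ((c t).phase p).memory) (he : ((c t).phase p).eligible = true) :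
    ((c t).report l p).status = cornerType (nbrs (c t).eligibleSet ((c 0).head p)) := by
  rw [← h.cornerType_eq hx, report, ownStatus, if_neg, if_pos he, hx.ports_eq]
  rw [hx.ports_eq]
  rintro ⟨i, hi, hi'⟩
  obtain ⟨m, hm, _⟩ := h i hi
  rw [hm] at hi'
  cases hi'

/-- If `q` knows which of its neighbors are Eligible, it has announced its corner type. -/
theorem Knows.announced_eq (hx : IsExecution l act c) {t : ℕ} {p q : P} {i : Fin 6}
    (h : Knows l c t q ((c t).phase q).memory) (he : ((c t).phase q).eligible = true)
    (hpq : (c 0).head q = (c 0).target l p i) :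
    announced ((c t).seen l p) i = cornerType (nbrs (c t).eligibleSet ((c 0).head q)) := by
  obtain ⟨j, hj⟩ := (l q).dirOf_surjective ((l p).dirOf i + 3)
  have hqp : (c 0).head p = (c 0).target l q j := by
    rw [target, hj, hpq, target, add_dir_add_dir_three]
  obtain ⟨m, hm, _⟩ := h j (hx.mem_ports.2 ⟨p, hqp⟩)
  have := hx.register_of_memory (t := t) (p := q) (i := j) (by rw [hm]; simp)
  rw [announced, hx.seen_eq_register hpq, this]
  exact h.status hx he

theorem Decides.choice_eq (hx : IsExecution l act c) {t : ℕ} {p : P} :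
    (c t).choice l p = decision (eligiblePorts ((c 0).ports l p) ((c t).seen l p))
      ((c t).seen l p) := by
  rw [Config.choice, hx.ports_eq]

/-! ### Elimination preserves simple connectedness -/

/-- A neighbor eliminated at the same stage is Stable, so the memory behind its last announcement
already agrees with the current flags, and the corner type announced is the true one. Nothing is
claimed about announcements of neighbors that survive. -/
theorem eliminable (hx : IsExecution l act c) {t : ℕ} {v : Vertex}
    (hv : v ∈ (c t).eligibleSet \ (c (t + 1)).eligibleSet) :
    Eliminable (c t).eligibleSet ((c t).eligibleSet \ (c (t + 1)).eligibleSet) v := by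
  have hdecides : ∀ q, (c 0).head q ∈ (c t).eligibleSet \ (c (t + 1)).eligibleSet →
      (c t).Decides l q ∧ (c t).choice l q = .eliminate := by
    rintro q ⟨h1, h2⟩
    rw [hx.mem_eligibleSet] at h1 h2
    exact (hx.not_eligible_succ h1 (Bool.not_eq_true _ ▸ h2)).2
  obtain ⟨p, rfl, -⟩ := hx.exists_of_mem_eligibleSet hv.1
  obtain ⟨hd, hc⟩ := hdecides p hv
  rw [Decides.choice_eq hx] at hc
  have hk := Decides.knows hx hd
  have htype := hk.cornerType_eq hx
  have hann : ∀ i, (c 0).target l p i ∈ (c t).eligibleSet \ (c (t + 1)).eligibleSet →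
      announced ((c t).seen l p) i =
        cornerType (nbrs (c t).eligibleSet ((c 0).target l p i)) := by
    intro i hi
    obtain ⟨q, hq, he⟩ := hx.exists_of_mem_eligibleSet hi.1
    rw [← hq] at hi ⊢
    have hdq := (hdecides q hi).1
    have hkq := Decides.knows hx hdq
    rw [← hdq.2.2.2] at hkq
    exact hkq.announced_eq hx he hq
  rcases decision_eliminate hc with ⟨h, i, hi, ha⟩ | ⟨h, i, hi, ha⟩ | ⟨h, ha⟩
  · refine .one (htype ▸ h) ⟨(l p).dirOf i, (hk.mem_eligiblePorts hx i).1 hi, fun h' => ?_⟩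
    rw [hann i h'] at ha
    exact ha
  · refine .two (htype ▸ h) ⟨(l p).dirOf i, (hk.mem_eligiblePorts hx i).1 hi, fun h' => ?_⟩
    rw [hann i h'] at ha
    exact ha
  · refine .three (htype ▸ h) fun j hj h' => ?_
    obtain ⟨i, rfl⟩ := (l p).dirOf_surjective j
    have := ha i (((l p).eq_triple (hk.mem_eligiblePorts hx)).2 hj)
    rw [hann i h'] at this
    exact this

theorem eligibleSet_succ_subset (hx : IsExecution l act c) (t : ℕ) :
    (c (t + 1)).eligibleSet ⊆ (c t).eligibleSet := by
  intro v hv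
  obtain ⟨q, rfl, h⟩ := hx.exists_of_mem_eligibleSet hv
  exact hx.mem_eligibleSet.2 (hx.eligible_of_succ h)

theorem eligibleSet_zero (hx : IsExecution l act c) :
    (c 0).eligibleSet = Set.range (c 0).head := by
  ext v
  constructor
  · rintro ⟨q, hq, _⟩; exact ⟨q, hq⟩
  · rintro ⟨q, hq⟩; exact ⟨q, hq, by rw [hx.phase_zero]⟩

theorem eligibleSet_invariant (hx : IsExecution l act c) (hne : (c 0).eligibleSet.Nonempty)
    (hconn : GridConnected (c 0).eligibleSet) (hcompl : GridConnected (c 0).eligibleSetᶜ)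
    (t : ℕ) : (c t).eligibleSet.Nonempty ∧ GridConnected (c t).eligibleSet ∧
      GridConnected (c t).eligibleSetᶜ := by
  induction t with
  | zero => exact ⟨hne, hconn, hcompl⟩
  | succ t ih =>
    obtain ⟨h1, h2, h3⟩ := ih
    have hD : ∀ v ∈ (c t).eligibleSet \ (c (t + 1)).eligibleSet,
        Dominated (c t).eligibleSet ((c t).eligibleSet \ (c (t + 1)).eligibleSet) v :=
      fun v hv => Eliminable.dominated Set.sdiff_subset (fun _ => hx.eliminable) hv
    rw [← Set.sdiff_sdiff_cancel_left (hx.eligibleSet_succ_subset t)]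
    exact ⟨Dominated.diff_nonempty h1 hD, h2.diff hD, h3.compl_diff hD⟩

end IsExecution

/-! ### Cliques of the grid -/

/-- If no neighbor of a `k`-corner vertex `v` has more than `k` neighbors, `v` and its neighbors
are all of `E`, and they are pairwise adjacent. -/
theorem pairwise_of_corner {E : Set Vertex} (hE : GridConnected E) {v : Vertex} (hv : v ∈ E)
    {k : Fin 4} (hk : k ≠ 3) (htype : cornerType (nbrs E v) = .corner k)
    (hcard : ∀ i ∈ nbrs E v, (nbrs E (v + dir i)).card ≤ k.val) :
    E.Pairwise GridAdj ∧ ∀ i ∈ nbrs E v, k.val ≤ (nbrs E (v + dir i)).card := by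
  have h3 : ∀ i, i + 3 ∈ nbrs E (v + dir i) := fun i => add_three_mem_nbrs.2 hv
  have hkA := card_of_cornerType htype
  -- `B` lists the directions from a neighbor of `v` to `v` and to the other neighbors of `v`. These
  -- are already `k` directions, so the bound leaves no further ones: `v` and its neighbors are
  -- closed under adjacency in `E`.
  suffices H : ∀ i ∈ nbrs E v, ∃ B : Finset (Fin 6), B ⊆ nbrs E (v + dir i) ∧ B.card = k.val ∧
      (∀ j ∈ B, v + dir i + dir j = v ∨ ∃ i' ∈ nbrs E v, v + dir i + dir j = v + dir i') ∧
      ∀ i' ∈ nbrs E v, i' ≠ i → GridAdj (v + dir i) (v + dir i') by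
    have hF : E ⊆ {u | u = v ∨ ∃ i ∈ nbrs E v, u = v + dir i} := by
      refine hE.eq_of_closed hv (Or.inl rfl) ?_
      rintro a b ⟨j, rfl⟩ - hb (rfl | ⟨i, hi, rfl⟩)
      · exact Or.inr ⟨j, mem_nbrs.2 hb, rfl⟩
      · obtain ⟨B, hB, hBk, hclosed, -⟩ := H i hi
        have := Finset.eq_of_subset_of_card_le hB (by rw [hBk]; exact hcard i hi)
        exact hclosed j (this ▸ mem_nbrs.2 hb)
    refine ⟨fun a ha b hb hab => ?_, fun i hi => ?_⟩
    · rcases hF ha with rfl | ⟨i, hi, rfl⟩ <;> rcases hF hb with rfl | ⟨j, hj, rfl⟩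
      · exact absurd rfl hab
      · exact gridAdj_add_dir _ _
      · exact (gridAdj_add_dir _ _).symm
      · obtain ⟨-, -, -, -, h⟩ := H i hi
        exact h j hj fun h' => hab (by rw [h'])
    · obtain ⟨B, hB, hBk, -⟩ := H i hi
      rw [← hBk]; exact Finset.card_le_card hB
  intro i hi
  have hcases : k = 0 ∨ k = 1 ∨ k = 2 := by clear * - hk; revert k; decide
  rcases hcases with rfl | rfl | rfl
  · rw [Finset.card_eq_zero.1 hkA] at hi
    simp at hi
  · have hA := eq_of_cornerType_one htype hi
    refine ⟨{i + 3}, Finset.singleton_subset_iff.2 (h3 i), rfl, fun j hj => Or.inl ?_, ?_⟩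
    · rw [Finset.mem_singleton.1 hj, add_dir_add_dir_three]
    · intro i' hi' hne
      rw [hA] at hi'
      exact absurd (Finset.mem_singleton.1 hi') hne
  · rcases eq_of_cornerType_two htype hi with hA | hA
    · have hi1 : i + 1 ∈ nbrs E v := by rw [hA]; simp
      refine ⟨{i + 3, i + 2}, ?_, ?_, ?_, ?_⟩
      · rw [Finset.insert_subset_iff, Finset.singleton_subset_iff]
        exact ⟨h3 i, add_two_mem_nbrs.2 hi1⟩
      · clear * -; revert i; decide
      · intro j hj
        rcases Finset.mem_insert.1 hj with rfl | hj
        · exact Or.inl (add_dir_add_dir_three v i)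
        · rw [Finset.mem_singleton.1 hj]
          exact Or.inr ⟨i + 1, hi1, add_dir_add_dir_two v i⟩
      · intro i' hi' hne
        rw [hA] at hi'
        rcases Finset.mem_insert.1 hi' with rfl | hi'
        · exact absurd rfl hne
        · exact gridAdj_dir_dir (Or.inl (Finset.mem_singleton.1 hi')) v
    · have hi5 : i + 5 ∈ nbrs E v := by rw [hA]; simp
      refine ⟨{i + 3, i + 4}, ?_, ?_, ?_, ?_⟩
      · rw [Finset.insert_subset_iff, Finset.singleton_subset_iff]
        exact ⟨h3 i, add_four_mem_nbrs.2 hi5⟩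
      · clear * -; revert i; decide
      · intro j hj
        rcases Finset.mem_insert.1 hj with rfl | hj
        · exact Or.inl (add_dir_add_dir_three v i)
        · rw [Finset.mem_singleton.1 hj]
          exact Or.inr ⟨i + 5, hi5, add_dir_add_dir_four v i⟩
      · intro i' hi' hne
        rw [hA] at hi'
        rcases Finset.mem_insert.1 hi' with rfl | hi'
        · exact absurd rfl hne
        · refine gridAdj_dir_dir (Or.inr ?_) v
          rw [Finset.mem_singleton.1 hi', add_assoc, show (5 + 1 : Fin 6) = 0 from rfl, add_zero]

theorem eq_of_pairwise {A : Finset (Fin 6)} (h : ∀ i ∈ A, ∀ j ∈ A, i ≠ j → j = i + 1 ∨ i = j + 1)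
    {i : Fin 6} (hi : i ∈ A) : A = {i} ∨ A = {i, i + 1} ∨ A = {i, i + 5} := by
  revert A i; decide +kernel

/-- All vertices of a clique have the same corner type. -/
theorem cornerType_of_pairwise {E : Set Vertex} (hE : E.Pairwise GridAdj) {v : Vertex}
    (hv : v ∈ E) : ∃ k : Fin 4, k ≠ 3 ∧ cornerType (nbrs E v) = .corner k ∧
      ∀ i ∈ nbrs E v, cornerType (nbrs E (v + dir i)) = .corner k := by
  have hdir : ∀ u, ∀ i ∈ nbrs E u, ∀ j ∈ nbrs E u, i ≠ j → j = i + 1 ∨ i = j + 1 :=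
    fun u i hi j hj hij => gridAdj_add_dir_iff.1 <| hE (mem_nbrs.1 hi) (mem_nbrs.1 hj)
      fun h => hij (dir_injective (add_left_cancel h))
  rcases (nbrs E v).eq_empty_or_nonempty with h0 | ⟨i, hi⟩
  · exact ⟨0, by decide, by rw [h0]; decide, by simp [h0]⟩
  have t1 : ∀ i : Fin 6, cornerType {i} = .corner 1 := by decide +kernel
  have t2 : ∀ i : Fin 6, cornerType {i, i + 1} = .corner 2 := by decide +kernel
  have t2' : ∀ i : Fin 6, cornerType {i, i + 5} = .corner 2 := by decide +kernel
  -- Adjacent vertices agree on their common neighbors, which excludes that one has type 1 and the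
  -- other type 2.
  have key : ∀ i ∈ nbrs E v, cornerType (nbrs E (v + dir i)) = cornerType (nbrs E v) := by
    intro i hi
    have h3 : i + 3 ∈ nbrs E (v + dir i) := add_three_mem_nbrs.2 hv
    have e2 := add_two_mem_nbrs (E := E) (v := v) (i := i)
    have e4 := add_four_mem_nbrs (E := E) (v := v) (i := i)
    have d1 : ∀ i : Fin 6, i + 2 ∉ ({i + 3} : Finset (Fin 6)) ∧
        i + 4 ∉ ({i + 3} : Finset (Fin 6)) ∧ i + 1 ∉ ({i} : Finset (Fin 6)) ∧
        i + 5 ∉ ({i} : Finset (Fin 6)) := by decide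
    rcases eq_of_pairwise (hdir v) hi with hA | hA | hA <;>
      rcases eq_of_pairwise (hdir _) h3 with hB | hB | hB
    · rw [hA, hB, t1, t1]
    · rw [hA, hB, add_assoc i 3 1] at e4
      exact absurd (e4.1 (by simp [show (3 + 1 : Fin 6) = 4 from rfl])) (d1 i).2.2.2
    · rw [hA, hB, add_assoc i 3 5] at e2
      exact absurd (e2.1 (by simp [show (3 + 5 : Fin 6) = 2 from rfl])) (d1 i).2.2.1
    · rw [hA, hB] at e2
      exact absurd (e2.2 (by simp)) (d1 i).1
    · rw [hA, hB, t2, t2]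
    · rw [hA, hB, t2, t2']
    · rw [hA, hB] at e4
      exact absurd (e4.2 (by simp)) (d1 i).2.1
    · rw [hA, hB, t2', t2]
    · rw [hA, hB, t2', t2']
  rcases eq_of_pairwise (hdir v) hi with hA | hA | hA
  · exact ⟨1, by decide, by rw [hA, t1], fun j hj => by rw [key j hj, hA, t1]⟩
  · exact ⟨2, by decide, by rw [hA, t2], fun j hj => by rw [key j hj, hA, t2]⟩
  · exact ⟨2, by decide, by rw [hA, t2'], fun j hj => by rw [key j hj, hA, t2']⟩

theorem ncard_le_three_of_pairwise {E : Set Vertex} (hE : E.Pairwise GridAdj) : E.ncard ≤ 3 := by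
  rcases E.eq_empty_or_nonempty with rfl | ⟨v, hv⟩
  · simp
  obtain ⟨k, hk, htype, -⟩ := cornerType_of_pairwise hE hv
  have hsub : E ⊆ (insert v ((nbrs E v).image fun i => v + dir i) : Finset Vertex) := by
    intro u hu
    rw [Finset.mem_coe, Finset.mem_insert]
    by_cases huv : u = v
    · exact Or.inl huv
    · obtain ⟨i, rfl⟩ := hE hv hu (Ne.symm huv)
      exact Or.inr (Finset.mem_image.2 ⟨i, mem_nbrs.2 hu, rfl⟩)
  refine (Set.ncard_le_ncard hsub (Finset.finite_toSet _)).trans ?_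
  rw [Set.ncard_coe_finset]
  have h1 := Finset.card_insert_le v ((nbrs E v).image fun i => v + dir i)
  have h2 : ((nbrs E v).image fun i => v + dir i).card ≤ _ := Finset.card_image_le
  have h3 := card_of_cornerType htype
  have h4 : k.val ≤ 2 := by clear * - hk; revert k; decide
  omega

namespace IsExecution

/-! ### The end of the phase -/

/-- The Eligible particles are pairwise adjacent, and they know which of their neighbors are
Eligible. -/
def IsFinal (l : P → PortLabeling) (c : ℕ → Config latticeConsumption P) (t : ℕ) : Prop :=
  (c t).eligibleSet.Pairwise GridAdj ∧
    ∀ p, ((c t).phase p).eligible = true → Knows l c t p ((c t).phase p).memory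

theorem Knows.congr {s t : ℕ} {p : P} {M : Fin 6 → Option Report}
    (h : (c s).eligibleSet = (c t).eligibleSet) (hk : Knows l c s p M) : Knows l c t p M := by
  unfold Knows at hk ⊢
  rwa [← h]

theorem Knows.seen (hx : IsExecution l act c) {t : ℕ} {p : P}
    (h : Knows l c t p ((c t).phase p).memory) : Knows l c t p ((c t).seen l p) := by
  refine hx.knows_seen fun i hi => seen_ne_none ?_
  obtain ⟨m, hm, _⟩ := h i hi
  rw [hm]; simp

/-- In a clique all corner types coincide and are at most 2. By exact knowledge they have been
announced correctly, so every test for elimination fails. -/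
theorem IsFinal.eligible_succ (hx : IsExecution l act c) {t : ℕ} (h : IsFinal l c t) {p : P}
    (hp : ((c t).phase p).eligible = true) : ((c (t + 1)).phase p).eligible = true := by
  by_contra hne
  obtain ⟨_, hd, hc⟩ := hx.not_eligible_succ hp (Bool.not_eq_true _ ▸ hne)
  rw [Decides.choice_eq hx] at hc
  have hk := Decides.knows hx hd
  obtain ⟨k, hk3, htype, hnbrs⟩ := cornerType_of_pairwise h.1 (hx.mem_eligibleSet.2 hp)
  rw [← hk.cornerType_eq hx] at htype
  have hann : ∀ i ∈ eligiblePorts ((c 0).ports l p) ((c t).seen l p),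
      announced ((c t).seen l p) i = .corner k := by
    intro i hi
    have hi' := (hk.mem_eligiblePorts hx i).1 hi
    obtain ⟨q, hq, he⟩ := hx.exists_of_mem_eligibleSet (dirOf_mem_nbrs.1 hi')
    rw [(h.2 q he).announced_eq hx he hq, hq]
    exact hnbrs _ hi'
  rcases decision_eliminate hc with ⟨h', i, hi, ha⟩ | ⟨h', i, hi, ha⟩ | ⟨h', ha⟩
  · exact ha ((hann i hi).trans (htype.symm.trans h'))
  · exact ha ((hann i hi).trans (htype.symm.trans h'))
  · rw [htype, CornerStatus.corner.injEq] at h'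
    exact hk3 h'

theorem IsFinal.succ (hx : IsExecution l act c) {t : ℕ} (h : IsFinal l c t) :
    IsFinal l c (t + 1) := by
  have hE : (c t).eligibleSet = (c (t + 1)).eligibleSet := by
    refine subset_antisymm (fun v hv => ?_) (hx.eligibleSet_succ_subset t)
    obtain ⟨q, rfl, he⟩ := hx.exists_of_mem_eligibleSet hv
    exact hx.mem_eligibleSet.2 (h.eligible_succ hx he)
  refine ⟨hE ▸ h.1, fun p hp => ?_⟩
  have hk := h.2 p (hx.eligible_of_succ hp)
  by_cases hact : p ∈ act t
  · rw [hx.memory_of_mem hact]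
    exact (hk.seen hx).congr hE
  · rw [hx.phase_of_notMem hact]
    exact hk.congr hE

/-- Eligible neighbors are never memorized as eliminated. -/
theorem eligible_of_memory (hx : IsExecution l act c) {t : ℕ} {p : P} {i : Fin 6} {m : Report}
    (hm : ((c t).phase p).memory i = some m) (hi : (c 0).target l p i ∈ (c t).eligibleSet) :
    m.eligible = true := by
  induction t with
  | zero => rw [hx.phase_zero] at hm; cases hm
  | succ t ih =>
    have hi' := hx.eligibleSet_succ_subset t hi
    by_cases hact : p ∈ act t
    · rw [hx.memory_of_mem hact] at hm
      obtain ⟨q, hq, he⟩ := hx.exists_of_mem_eligibleSet hi'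
      rw [hx.seen_eq_some hq hm]
      exact he
    · rw [hx.phase_of_notMem hact] at hm
      exact ih hm hi'

/-- The knowledge of `p` is exact. That of its neighbors may be outdated, but only by counting
eliminated particles as Eligible; so a neighbor announcing `k` has at most `k` Eligible neighbors,
as `pairwise_of_corner` requires. -/
theorem isFinal_of_becomeCandidate (hx : IsExecution l act c) {t : ℕ}
    (hconn : GridConnected (c t).eligibleSet) {p : P} (hd : (c t).Decides l p)
    (hc : (c t).choice l p = .becomeCandidate) : IsFinal l c t := by
  rw [Decides.choice_eq hx] at hc
  have hk := Decides.knows hx hd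
  obtain ⟨k, hk3, htype, hann⟩ := decision_becomeCandidate hc
  rw [hk.cornerType_eq hx] at htype
  have hp := hx.mem_eligibleSet.2 hd.2.1
  -- the Eligible neighbors know at least `k` Eligible neighbors
  have hq : ∀ q, ((c t).phase q).eligible = true → ∀ i, (c 0).head q = (c 0).target l p i →
      (∀ j ∈ (c 0).ports l q, ((c t).phase q).memory j ≠ none) ∧
      (eligiblePorts ((c 0).ports l q) ((c t).phase q).memory).card = k.val := by
    intro q he i hqi
    have hi := (hk.mem_eligiblePorts hx i).2
      (dirOf_mem_nbrs.2 (hqi ▸ hx.mem_eligibleSet.2 he))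
    have ha := hann i hi
    obtain ⟨m, hm⟩ := Option.ne_none_iff_exists'.1 (announced_ne_unknown (M := (c t).seen l p)
      (i := i) (by rw [ha]; simp))
    have hstatus : ((c t).report l q).status = .corner k := by
      rw [← hx.seen_eq_some hqi hm, ← ha, announced, hm]
    rw [report, ownStatus, hx.ports_eq, if_pos he] at hstatus
    split_ifs at hstatus with hnone
    push Not at hnone
    exact ⟨hnone, card_of_cornerType hstatus⟩
  have hsub : ∀ q, (∀ j ∈ (c 0).ports l q, ((c t).phase q).memory j ≠ none) →
      nbrs (c t).eligibleSet ((c 0).head q) ⊆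
        (eligiblePorts ((c 0).ports l q) ((c t).phase q).memory).image (l q).dirOf := by
    intro q hnone d hd'
    obtain ⟨j, rfl⟩ := (l q).dirOf_surjective d
    have hj := dirOf_mem_nbrs.1 hd'
    obtain ⟨r, hr, _⟩ := hx.exists_of_mem_eligibleSet hj
    have hport := hx.mem_ports.2 ⟨r, hr⟩
    obtain ⟨m, hm⟩ := Option.ne_none_iff_exists'.1 (hnone j hport)
    exact Finset.mem_image_of_mem _
      (Finset.mem_filter.2 ⟨hport, m, hm, hx.eligible_of_memory hm hj⟩)
  obtain ⟨hpair, hcard⟩ := pairwise_of_corner hconn hp hk3 htype fun d hd' => by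
    obtain ⟨i, rfl⟩ := (l p).dirOf_surjective d
    obtain ⟨q, hqi, he⟩ := hx.exists_of_mem_eligibleSet (dirOf_mem_nbrs.1 hd')
    obtain ⟨hnone, hB⟩ := hq q he i hqi
    have h1 := Finset.card_le_card (hsub q hnone)
    rw [hqi] at h1
    exact (h1.trans Finset.card_image_le).trans hB.le
  refine ⟨hpair, fun q he => ?_⟩
  by_cases hqp : q = p
  · rw [hqp, hd.2.2.2]; exact hk
  obtain ⟨d, hd'⟩ := hpair hp (hx.mem_eligibleSet.2 he)
    fun h => hqp (hx.initial.head_injective h).symm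
  obtain ⟨i, rfl⟩ := (l p).dirOf_surjective d
  obtain ⟨hnone, hB⟩ := hq q he i hd'
  -- The true neighborhood of `q` has at least `k` elements and is contained in the memorized one,
  -- which has exactly `k`; so the memory of `q` is exact, too.
  have hle := hcard _ (mem_nbrs.2 (hd' ▸ hx.mem_eligibleSet.2 he))
  rw [← hd'] at hle
  have heq := Finset.eq_of_subset_of_card_le (hsub q hnone)
    ((Finset.card_image_le.trans hB.le).trans hle)
  intro j hj
  obtain ⟨m, hm⟩ := Option.ne_none_iff_exists'.1 (hnone j hj)
  refine ⟨m, hm, fun hme => ?_, hx.eligible_of_memory hm⟩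
  rw [← dirOf_mem_nbrs, heq]
  exact Finset.mem_image_of_mem _ (Finset.mem_filter.2 ⟨hj, m, hm, hme⟩)

theorem isFinal_of_candidate (hx : IsExecution l act c)
    (hconn : ∀ t, GridConnected (c t).eligibleSet) {t : ℕ} {p : P}
    (h : ((c t).phase p).candidate = true) : IsFinal l c t := by
  induction t with
  | zero => rw [hx.phase_zero] at h; cases h
  | succ t ih =>
    refine IsFinal.succ hx ?_
    cases hc : ((c t).phase p).candidate with
    | true => exact ih hc
    | false =>
      obtain ⟨_, hd, hch⟩ := hx.candidate_succ hc h
      exact hx.isFinal_of_becomeCandidate (hconn t) hd hch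

end IsExecution

/-! ### Progress -/

theorem cornerType_ne_unknown (A : Finset (Fin 6)) : cornerType A ≠ .unknown := by
  revert A; decide +kernel

theorem middle_unique {i j : Fin 6}
    (h : ({i - 1, i, i + 1} : Finset (Fin 6)) = {j - 1, j, j + 1}) : i = j := by
  revert i j; decide +kernel

namespace IsExecution

/-- Every particle is active at some stage from `a` on, but before `b`. -/
def AllActive (act : ℕ → Set P) (a b : ℕ) : Prop := ∀ p, ∃ t, a ≤ t ∧ t < b ∧ p ∈ act t

/-- No Eligible or Candidate flag changes between the stages `a` and `b`. -/
def FlagsConstant (c : ℕ → Config latticeConsumption P) (a b : ℕ) : Prop :=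
  ∀ p, ((c a).phase p).eligible = ((c b).phase p).eligible ∧
    ((c a).phase p).candidate = ((c b).phase p).candidate

theorem exists_last_activation (hx : IsExecution l act c) {a t : ℕ} {p : P}
    (h : ∃ s, a ≤ s ∧ s < t ∧ p ∈ act s) :
    ∃ s, a ≤ s ∧ s < t ∧ ((c t).phase p).memory = (c s).seen l p := by
  induction t with
  | zero => obtain ⟨s, _, hs, _⟩ := h; exact absurd hs (Nat.not_lt_zero s)
  | succ t ih =>
    obtain ⟨s, has, hst, hs⟩ := h
    by_cases hp : p ∈ act t
    · exact ⟨t, has.trans (Nat.lt_succ_iff.1 hst), Nat.lt_succ_self t, hx.memory_of_mem hp⟩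
    · rcases Nat.lt_succ_iff_lt_or_eq.1 hst with hst | rfl
      · obtain ⟨s', h1, h2, h3⟩ := ih ⟨s, has, hst, hs⟩
        exact ⟨s', h1, h2.trans (Nat.lt_succ_self t), by rw [hx.phase_of_notMem hp, h3]⟩
      · exact absurd hs hp

theorem AllActive.exists_last (hx : IsExecution l act c) {a b t : ℕ} (h : AllActive act a b)
    (hbt : b ≤ t) (p : P) : ∃ s, a ≤ s ∧ s < t ∧ ((c t).phase p).memory = (c s).seen l p := by
  obtain ⟨s, h1, h2, h3⟩ := h p
  exact hx.exists_last_activation ⟨s, h1, h2.trans_le hbt, h3⟩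

theorem FlagsConstant.of_le (hx : IsExecution l act c) {a b s t : ℕ} (h : FlagsConstant c a b)
    (has : a ≤ s) (hst : s ≤ t) (htb : t ≤ b) : FlagsConstant c s t := by
  intro p
  obtain ⟨h1, h2⟩ := h p
  constructor
  · cases hs : ((c s).phase p).eligible with
    | true =>
      rw [hx.eligible_antitone has hs] at h1
      exact (hx.eligible_antitone htb h1.symm).symm
    | false =>
      by_contra hne
      rw [hx.eligible_antitone hst (Bool.not_eq_false _ ▸ Ne.symm hne)] at hs
      cases hs
  · cases hs : ((c s).phase p).candidate with
    | true => exact (hx.candidate_monotone hst hs).symm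
    | false =>
      by_contra hne
      have ht : ((c t).phase p).candidate = true := Bool.not_eq_false _ ▸ Ne.symm hne
      rw [hx.candidate_monotone htb ht] at h2
      rw [hx.candidate_monotone has h2] at hs
      cases hs

theorem FlagsConstant.eligibleSet_eq (hx : IsExecution l act c) {a b : ℕ}
    (h : FlagsConstant c a b) : (c a).eligibleSet = (c b).eligibleSet := by
  ext v
  constructor
  · intro hv
    obtain ⟨q, rfl, he⟩ := hx.exists_of_mem_eligibleSet hv
    exact hx.mem_eligibleSet.2 ((h q).1 ▸ he)
  · intro hv
    obtain ⟨q, rfl, he⟩ := hx.exists_of_mem_eligibleSet hv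
    exact hx.mem_eligibleSet.2 ((h q).1.symm ▸ he)

theorem report_eq_of_knows (hx : IsExecution l act c) {s t : ℕ} (h : FlagsConstant c s t) {q : P}
    (hs : Knows l c s q ((c s).phase q).memory) (ht : Knows l c t q ((c t).phase q).memory) :
    (c s).report l q = (c t).report l q := by
  have hstatus : ((c s).report l q).status = ((c t).report l q).status := by
    cases he : ((c s).phase q).eligible with
    | true => rw [hs.status hx he, ht.status hx ((h q).1 ▸ he), h.eligibleSet_eq hx]
    | false =>
      have key : ∀ r, Knows l c r q ((c r).phase q).memory → ((c r).phase q).eligible = false →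
          ((c r).report l q).status = .notCorner := by
        intro r hr her
        rw [report, ownStatus, if_neg, her, if_neg (by simp)]
        rw [hx.ports_eq]
        rintro ⟨i, hi, hi'⟩
        obtain ⟨m, hm, _⟩ := hr i hi
        rw [hm] at hi'
        cases hi'
      rw [key s hs he, key t ht ((h q).1 ▸ he)]
  obtain ⟨h1, h2⟩ := h q
  calc (c s).report l q = ⟨((c s).phase q).eligible, ((c s).phase q).candidate,
        ((c s).report l q).status⟩ := rfl
    _ = (c t).report l q := by rw [h1, h2, hstatus]; rfl

theorem status_ne_unknown (hx : IsExecution l act c) {t : ℕ} {q : P}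
    (h : Knows l c t q ((c t).phase q).memory) : ((c t).report l q).status ≠ .unknown := by
  rw [report, ownStatus, if_neg]
  · split_ifs
    · exact cornerType_ne_unknown _
    · simp
  · rw [hx.ports_eq]
    rintro ⟨i, hi, hi'⟩
    obtain ⟨m, hm, _⟩ := h i hi
    rw [hm] at hi'
    cases hi'

/-- If no flag changes for four rounds, no particle that is Eligible, but not Candidate, is an
unlocked corner particle. -/
theorem waits_of_flagsConstant (hx : IsExecution l act c) {T₀ T₁ T₂ T₃ T₄ : ℕ}
    (h₀ : AllActive act T₀ T₁) (h₁ : AllActive act T₁ T₂) (h₂ : AllActive act T₂ T₃)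
    (h₃ : AllActive act T₃ T₄) (h01 : T₀ ≤ T₁) (h12 : T₁ ≤ T₂) (h23 : T₂ ≤ T₃)
    (hconst : FlagsConstant c T₀ T₄) {p : P} (he : ((c T₀).phase p).eligible = true)
    (hc : ((c T₀).phase p).candidate = false) :
    let A := nbrs (c T₀).eligibleSet ((c 0).head p)
    cornerType A ≠ .corner 0 ∧ cornerType A ≠ .corner 1 ∧ cornerType A ≠ .corner 2 ∧
      ∀ i, A = {i + 5, i, i + 1} →
        cornerType (nbrs (c T₀).eligibleSet ((c 0).head p + dir i)) = .corner 3 := by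
  intro A
  obtain ⟨t, ht3, ht4, hact⟩ := h₃ p
  -- After the first round every particle has made an announcement.
  have hreg : ∀ s, T₁ ≤ s → ∀ q, register l act c s q = some ((c s).report l q) := by
    intro s hs q
    obtain ⟨r, _, hr, hq⟩ := h₀ q
    exact if_pos ⟨r, hr.trans_le hs, hq⟩
  have hseen : ∀ s, T₁ ≤ s → ∀ q, Knows l c s q ((c s).seen l q) := by
    intro s hs q
    refine hx.knows_seen fun i hi => ?_
    obtain ⟨r, hr⟩ := hx.mem_ports.1 hi
    rw [hx.seen_eq_register hr, hreg s hs r]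
    simp
  -- In the second round every particle memorizes flags that no longer change. From then on reports
  -- are exact and constant.
  have hknows : ∀ s, T₂ ≤ s → s ≤ T₄ → ∀ q, Knows l c s q ((c s).phase q).memory := by
    intro s hs hs4 q
    obtain ⟨r, hr1, hrs, hmem⟩ := AllActive.exists_last hx h₁ hs q
    rw [hmem]
    exact (hseen r hr1 q).congr
      ((hconst.of_le hx (h01.trans hr1) hrs.le hs4).eligibleSet_eq hx)
  have hT : T₀ ≤ t := by omega
  have hconst_t := hconst.of_le hx le_rfl hT ht4.le
  have hET := hconst_t.eligibleSet_eq hx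
  have ht2 : T₂ ≤ t := h23.trans ht3
  have hd : (c t).Decides l p := by
    refine ⟨fun i hi => ?_, (hconst_t p).1 ▸ he, (hconst_t p).2 ▸ hc, ?_⟩
    · rw [hx.ports_eq] at hi
      obtain ⟨q, hq⟩ := hx.mem_ports.1 hi
      rw [announced, hx.seen_eq_register hq, hreg t (h12.trans ht2)]
      exact hx.status_ne_unknown (hknows t ht2 ht4.le q)
    -- In the third round `p` memorizes the final reports, so that its activation in the fourth
    -- finds nothing new and `p` is Stable.
    · obtain ⟨s, hs2, hst, hmem⟩ := AllActive.exists_last hx h₂ ht3 p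
      funext i
      by_cases hi : i ∈ (c 0).ports l p
      · obtain ⟨q, hq⟩ := hx.mem_ports.1 hi
        rw [hmem, hx.seen_eq_register hq, hx.seen_eq_register hq, hreg s (h12.trans hs2),
          hreg t (h12.trans ht2), hx.report_eq_of_knows
            (hconst.of_le hx (by omega) hst.le ht4.le) (hknows s hs2 (by omega) q)
            (hknows t ht2 ht4.le q)]
      · rw [seen, updateMemory, hx.mail_of_notMem_ports hi]
  have hconst' := hconst.of_le hx hT (Nat.le_succ t) ht4
  have hwait : (c t).choice l p = .wait := by
    cases hch : (c t).choice l p with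
    | wait => rfl
    | eliminate =>
      have h1 := hx.eliminated_of_choice hact hd hch
      rw [← (hconst' p).1, hd.2.1] at h1
      cases h1
    | becomeCandidate =>
      have h1 := hx.candidate_of_choice hact hd hch
      rw [← (hconst' p).2, hd.2.2.1] at h1
      cases h1
  rw [Decides.choice_eq hx] at hwait
  have hk := hseen t (h12.trans ht2) p
  obtain ⟨g0, g1, g2, g3⟩ := decision_wait hwait
  rw [hk.cornerType_eq hx, ← hET] at g0 g1 g2 g3
  refine ⟨g0, g1, g2, fun j hj => ?_⟩
  have hj3 : cornerType A = .corner 3 := hj ▸ cornerType_three j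
  obtain ⟨i, hi, ha⟩ := g3 hj3
  obtain ⟨i', rfl⟩ := (l p).dirOf_surjective j
  have hi' := ((l p).eq_triple (hk.mem_eligiblePorts hx)).2 (by rw [← hET]; exact hj)
  obtain rfl := middle_unique (hi.symm.trans hi')
  have hmem : i ∈ eligiblePorts ((c 0).ports l p) ((c t).seen l p) := by rw [hi]; simp
  obtain ⟨q, hq, heq⟩ := hx.exists_of_mem_eligibleSet
    (dirOf_mem_nbrs.1 ((hk.mem_eligiblePorts hx i).1 hmem))
  rw [(hknows t ht2 ht4.le q).announced_eq hx heq hq, ← hET, hq] at ha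
  exact ha

/-- If no flag changes for four rounds, all Eligible particles are Candidates. -/
theorem candidate_of_flagsConstant [Finite P] (hx : IsExecution l act c)
    (hinv : ∀ t, (c t).eligibleSet.Nonempty ∧ GridConnected (c t).eligibleSet ∧
      GridConnected (c t).eligibleSetᶜ)
    {T₀ T₁ T₂ T₃ T₄ : ℕ} (h₀ : AllActive act T₀ T₁) (h₁ : AllActive act T₁ T₂)
    (h₂ : AllActive act T₂ T₃) (h₃ : AllActive act T₃ T₄) (h01 : T₀ ≤ T₁) (h12 : T₁ ≤ T₂)
    (h23 : T₂ ≤ T₃) (hconst : FlagsConstant c T₀ T₄) {p : P}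
    (he : ((c T₀).phase p).eligible = true) : ((c T₀).phase p).candidate = true := by
  have hwaits := fun p => hx.waits_of_flagsConstant (p := p) h₀ h₁ h₂ h₃ h01 h12 h23 hconst
  by_contra hne
  by_cases hcand : ∃ q, ((c T₀).phase q).candidate = true
  · obtain ⟨q, hq⟩ := hcand
    have hfinal := hx.isFinal_of_candidate (fun t => (hinv t).2.1) hq
    obtain ⟨k, hk3, htype, -⟩ := cornerType_of_pairwise hfinal.1 (hx.mem_eligibleSet.2 he)
    obtain ⟨g0, g1, g2, -⟩ := hwaits p he (Bool.not_eq_true _ ▸ hne)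
    have hcases : k = 0 ∨ k = 1 ∨ k = 2 := by clear * - hk3; revert k; decide
    rcases hcases with rfl | rfl | rfl
    exacts [g0 htype, g1 htype, g2 htype]
  · push Not at hcand
    have hfin : (c T₀).eligibleSet.Finite := by
      refine (Set.finite_range (c 0).head).subset fun v hv => ?_
      obtain ⟨q, rfl, _⟩ := hx.exists_of_mem_eligibleSet hv
      exact ⟨q, rfl⟩
    obtain ⟨hE, -, hcompl⟩ := hinv T₀
    obtain ⟨v, hv, hcorner⟩ := exists_unlocked_corner (E := hfin.toFinset)
      (by simpa using hE) (by simpa using hcompl)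
    rw [Set.Finite.coe_toFinset] at hcorner
    obtain ⟨q, rfl, heq⟩ := hx.exists_of_mem_eligibleSet (hfin.mem_toFinset.1 hv)
    obtain ⟨g0, g1, g2, g3⟩ := hwaits q heq (Bool.not_eq_true _ ▸ hcand q)
    rcases hcorner with h | h | h | ⟨i, hi, h⟩
    exacts [g0 h, g1 h, g2 h, h (g3 i hi)]

/-- The number of flags that can still change. -/
def openFlags [Fintype P] (c : Config latticeConsumption P) : ℕ :=
  (Finset.univ.filter fun p => (c.phase p).eligible = true).card +
    (Finset.univ.filter fun p => (c.phase p).candidate = false).card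

/-- Both counted sets can only shrink, so equal counts mean equal sets. -/
theorem flagsConstant_of_openFlags_le [Fintype P] (hx : IsExecution l act c) {a b : ℕ}
    (hab : a ≤ b) (h : openFlags (c a) ≤ openFlags (c b)) : FlagsConstant c a b := by
  classical
  have h1 : (Finset.univ.filter fun p => ((c b).phase p).eligible = true) ⊆
      Finset.univ.filter fun p => ((c a).phase p).eligible = true := by
    intro p hp
    simp only [Finset.mem_filter, Finset.mem_univ, true_and] at hp ⊢
    exact hx.eligible_antitone hab hp
  have h2 : (Finset.univ.filter fun p => ((c b).phase p).candidate = false) ⊆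
      Finset.univ.filter fun p => ((c a).phase p).candidate = false := by
    intro p hp
    simp only [Finset.mem_filter, Finset.mem_univ, true_and] at hp ⊢
    by_contra hne
    rw [hx.candidate_monotone hab (Bool.not_eq_false _ ▸ hne)] at hp
    cases hp
  have h1' := Finset.card_le_card h1
  have h2' := Finset.card_le_card h2
  unfold openFlags at h
  have e1 := Finset.eq_of_subset_of_card_le h1 (by omega)
  have e2 := Finset.eq_of_subset_of_card_le h2 (by omega)
  intro p
  have f1 := Finset.ext_iff.1 e1 p
  have f2 := Finset.ext_iff.1 e2 p
  simp only [Finset.mem_filter, Finset.mem_univ, true_and] at f1 f2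
  exact ⟨(Bool.eq_iff_iff.2 f1).symm, by
    cases h : ((c b).phase p).candidate with
    | false => exact f2.1 h
    | true => exact Bool.not_eq_false _ ▸ fun h' => by rw [f2.2 h'] at h; cases h⟩

end IsExecution

/-! ### Rounds -/

theorem allActive_round [Finite P] (hfair : Fair act) (k : ℕ) :
    IsExecution.AllActive act (roundEnd act k) (roundEnd act (k + 1)) := by
  -- Without this, `sInf` could take its default value 0 on the empty set. Fairness and finiteness
  -- make the infimum a genuine end of round.
  have hne : {t | ∀ p, ∃ t', roundEnd act k ≤ t' ∧ t' < t ∧ p ∈ act t'}.Nonempty := by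
    choose f hf hf' using fun p => hfair p (roundEnd act k)
    obtain ⟨N, hN⟩ := (Set.finite_range f).bddAbove
    exact ⟨N + 1, fun p => ⟨f p, hf p, Nat.lt_succ_of_le (hN ⟨p, rfl⟩), hf' p⟩⟩
  exact Nat.sInf_mem hne

theorem roundEnd_monotone [Finite P] [Nonempty P] (hfair : Fair act) :
    Monotone (roundEnd act) := by
  refine monotone_nat_of_le_succ fun k => ?_
  obtain ⟨t, h1, h2, _⟩ := allActive_round hfair k (Classical.arbitrary P)
  exact h1.trans h2.le

/-- Within eight rounds per particle, all Eligible particles are Candidates. -/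
theorem IsExecution.exists_all_candidates [Fintype P] (hx : IsExecution l act c)
    (hfair : Fair act)
    (hinv : ∀ t, (c t).eligibleSet.Nonempty ∧ GridConnected (c t).eligibleSet ∧
      GridConnected (c t).eligibleSetᶜ) :
    ∃ s ≤ roundEnd act (8 * Fintype.card P),
      ∀ p, ((c s).phase p).eligible = true → ((c s).phase p).candidate = true := by
  classical
  obtain ⟨p₀, -⟩ := (hinv 0).1.choose_spec
  have : Nonempty P := ⟨p₀⟩
  have hmono := roundEnd_monotone hfair
  by_contra! hno
  -- Each block of four rounds uses up at least one of the at most `2n` open flags. After `2n`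
  -- blocks none is left, although some particle is still Eligible.
  have hcount : ∀ j ≤ 2 * Fintype.card P,
      openFlags (c (roundEnd act (4 * j))) + j ≤ 2 * Fintype.card P := by
    intro j
    induction j with
    | zero =>
      intro _
      have h1 := Finset.card_filter_le (Finset.univ : Finset P)
        fun p => ((c (roundEnd act (4 * 0))).phase p).eligible = true
      have h2 := Finset.card_filter_le (Finset.univ : Finset P)
        fun p => ((c (roundEnd act (4 * 0))).phase p).candidate = false
      rw [Finset.card_univ] at h1 h2
      unfold openFlags
      omega
    | succ j ih =>
      intro hj
      have ih := ih (by omega)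
      by_contra hlt
      have hle : openFlags (c (roundEnd act (4 * j))) ≤
          openFlags (c (roundEnd act (4 * (j + 1)))) := by omega
      have hconst := hx.flagsConstant_of_openFlags_le (hmono (by omega)) hle
      obtain ⟨p, he, hc⟩ := hno (roundEnd act (4 * j)) (hmono (by omega))
      exact hc (hx.candidate_of_flagsConstant hinv (allActive_round hfair (4 * j))
        (allActive_round hfair (4 * j + 1)) (allActive_round hfair (4 * j + 2))
        (allActive_round hfair (4 * j + 3)) (hmono (by omega)) (hmono (by omega))
        (hmono (by omega)) hconst he)
  have hlast := hcount _ le_rfl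
  obtain ⟨v, hv⟩ := (hinv (roundEnd act (4 * (2 * Fintype.card P)))).1
  obtain ⟨q, -, he⟩ := hx.exists_of_mem_eligibleSet hv
  have hpos : 0 < openFlags (c (roundEnd act (4 * (2 * Fintype.card P)))) :=
    Nat.add_pos_left (Finset.card_pos.2 ⟨q, by simpa using he⟩) _
  omega

theorem IsExecution.occupiedBy_univ (hx : IsExecution l act c) (t : ℕ) :
    (c t).occupiedBy Set.univ = (c 0).eligibleSet := by
  rw [hx.eligibleSet_zero]
  ext v
  simp [occupiedBy, hx.tail_eq, hx.head_eq t]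

theorem IsExecution.occupiedBy_eligible (hx : IsExecution l act c) (t : ℕ) :
    (c t).occupiedBy {p | (c t).Eligible p} = (c t).eligibleSet := by
  ext v
  simp only [occupiedBy, hx.tail_eq, eligibleSet, Set.mem_ofPred_eq, reduceCtorEq, or_false]
  exact exists_congr fun p => and_comm

theorem theorem3p1 :
    ∃ K : ℕ, ∀ (n : ℕ) (S₀ : Set Plane), IsSimplyConnectedShape S₀ →
      ∀ (l : Fin n → PortLabeling) (act : ℕ → Set (Fin n))
        (c : ℕ → Config latticeConsumption (Fin n)),
        IsExecution l act c → Fair act →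
        FormsShape ((c 0).occupiedBy Set.univ) S₀ →
        ∃ s : ℕ, s ≤ roundEnd act (K * n) ∧
          (1 ≤ {p | (c s).Candidate p}.ncard ∧ {p | (c s).Candidate p}.ncard ≤ 3) ∧
          (∀ p q, (c s).Candidate p → (c s).Candidate q → p ≠ q →
            GridAdj ((c s).head p) ((c s).head q)) ∧
          (∀ p, ¬ (c s).Candidate p → ¬ (c s).Eligible p) ∧
          ∀ t ≤ s,
            (∀ p, (c t).head p = (c 0).head p ∧ (c t).tail p = none) ∧
            FormsShape ((c t).occupiedBy Set.univ) S₀ ∧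
            ∃ S : Set Plane, IsSimplyConnectedShape S ∧
              FormsShape ((c t).occupiedBy {p | (c t).Eligible p}) S := by
  -- Four rounds for each of the two flags per particle.
  refine ⟨8, fun n S₀ hS₀ l act c hx hfair hforms => ?_⟩
  rw [hx.occupiedBy_univ] at hforms
  have hfin : ∀ t, (c t).eligibleSet.Finite := fun t => by
    refine (Set.finite_range (c 0).head).subset fun v hv => ?_
    obtain ⟨q, rfl, _⟩ := hx.exists_of_mem_eligibleSet hv
    exact ⟨q, rfl⟩
  have hinv := hx.eligibleSet_invariant (nonempty_of_formsShape hS₀.toIsShape hforms)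
    (gridConnected_of_formsShape hS₀.toIsShape hforms)
    (gridConnected_compl_of_formsShape (hfin 0) hS₀ hforms)
  obtain ⟨s, hs, hall⟩ := hx.exists_all_candidates hfair hinv
  rw [Fintype.card_fin] at hs
  obtain ⟨v, hv⟩ := (hinv s).1
  obtain ⟨q, rfl, hq⟩ := hx.exists_of_mem_eligibleSet hv
  have hfinal := hx.isFinal_of_candidate (fun t => (hinv t).2.1) (hall q hq)
  have himage : (c 0).head '' {p | (c s).Candidate p} ⊆ (c s).eligibleSet := by
    rintro _ ⟨p, hp, rfl⟩
    exact hx.mem_eligibleSet.2 (hx.eligible_of_candidate hp)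
  refine ⟨s, hs, ⟨?_, ?_⟩, ?_, fun p hp he => hp (hall p he), fun t _ => ⟨fun p =>
    ⟨hx.head_eq t p, hx.tail_eq t p⟩, ?_, spannedShape (c t).eligibleSet, ?_, ?_⟩⟩
  · exact (Set.ncard_pos (Set.toFinite _)).2 ⟨q, hall q hq⟩
  · rw [← Set.ncard_image_of_injective _ hx.initial.head_injective]
    exact (Set.ncard_le_ncard himage (hfin s)).trans (ncard_le_three_of_pairwise hfinal.1)
  · intro p r hp hr hne
    rw [hx.head_eq s p, hx.head_eq s r]
    exact hfinal.1 (himage ⟨p, hp, rfl⟩) (himage ⟨r, hr, rfl⟩)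
      fun h => hne (hx.initial.head_injective h)
  · rwa [hx.occupiedBy_univ]
  · exact isSimplyConnectedShape_spannedShape (hfin t) (hinv t).1 (hinv t).2.1 (hinv t).2.2
  · rw [hx.occupiedBy_eligible]
    exact formsShape_spannedShape _
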